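/- Let $\mathcal S$ be the category of spaces (= simplicial sets), let $\Delta$ be the category of the finite nonempty ordinals $[q]=\{0<\dots<q\}$, and for $0\le n<\infty$ let $\Delta^{<n+1}\subset\Delta$ be the full subcategory on the $[q]$ with $q<n+1$; put $\Delta^{<\infty+1}=\Delta$. For a small category $D$ and functors $A,B\colon D\to\mathcal S$, let $\hom(A,B)$ be the mapping space with $k$-simplices the natural transformations $A\times\Delta[k]\to B$. Let $\operatorname{holim}_D X=\hom(N(D/ -),X)$ be the Bousfield–Kan homotopy limit, where the $m$-simplices of the nerve $N(C)$ of a category $C$ are the chains $c_0\leftarrow c_1\leftarrow\dots\leftarrow c_m$; for a functor $Z^\bullet$ on $\Delta$ write $\operatorname{holim}_{\Delta^{<n+1}}Z^\bullet$ for the homotopy limit of its restriction. A cosimplicial space $Z^\bullet\colon\Delta\to\mathcal S$ is fibrant if for every $n\ge0$ the matching map $Z^n\to M^nZ^\bullet=\lim_{[n]\twoheadrightarrow[p],\,p<n}Z^p$ is a Kan fibration. Let $\operatorname{Tot}_nZ^\bullet=\hom(\operatorname{sk}_n\Delta,Z^\bullet)$, where $\operatorname{sk}_n\Delta$ is the cosimplicial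 space $[q]\mapsto\operatorname{sk}_n\Delta[q]$, and $\operatorname{Tot}_\infty Z^\bullet=\operatorname{Tot}Z^\bullet=\hom(\Delta,Z^\bullet)$. For $0\le n\le\infty$, restriction along $\Delta^{<n+1}\subset\Delta$ followed by precomposition with the zeroth vertex map $$z\colon N(\Delta^{<n+1}/[q])\to\Delta[q]=\operatorname{sk}_n\Delta[q]\quad([q]\in\Delta^{<n+1}),\qquad (\alpha\colon[p]\to[q])\mapsto\alpha(0),$$ is a map $z^*\colon\operatorname{Tot}_nZ^\bullet\to\operatorname{holim}_{\Delta^{<n+1}}Z^\bullet$; for $n=\infty$ it is the Bousfield–Kan map $\operatorname{Tot}Z^\bullet\to\operatorname{holim}_\Delta Z^\bullet$. **Proposition.** For every fibrant cosimplicial space $Z^\bullet$ and every $0\le n\le\infty$, the map $$z^*\colon\operatorname{Tot}_nZ^\bullet\xrightarrow{\ \simeq\ }\operatorname{holim}_{\Delta^{<n+1}}Z^\bullet$$ is a weak equivalence. These maps are natural in $Z^\bullet$, and they are compatible for varying $n$: for $0\le n\le m\le\infty$ the composites $\operatorname{Tot}_mZ^\bullet\to\operatorname{Tot}_nZ^\bullet\xrightarrow{z^*}\operatorname{holim}_{\Delta^{<n+1}}Z^\bullet$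 and $\operatorname{Tot}_mZ^\bullet\xrightarrow{z^*}\operatorname{holim}_{\Delta^{<m+1}}Z^\bullet\to\operatorname{holim}_{\Delta^{<n+1}}Z^\bullet$ agree, the unnamed maps being induced by $\operatorname{sk}_n\Delta\subset\operatorname{sk}_m\Delta$ (with $\operatorname{sk}_\infty\Delta=\Delta$) and $\Delta^{<n+1}\subset\Delta^{<m+1}$. -/

import Mathlib

open CategoryTheory MonoidalCategory Opposite Simplicial HomotopicalAlgebra
open scoped SSet.modelCategoryQuillen

universe u

noncomputable section

namespace CosimplicialSpace

/-! ### Weak equivalences of spaces (= simplicial sets) -/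

/-- A map of simplicial sets `f : X ⟶ Y` is a weak (homotopy) equivalence if for every Kan
complex `K` the map `f^* : π₀ hom(Y, K) → π₀ hom(X, K)`, i.e. `[Y, K] → [X, K]`,
is a bijection. -/
def IsWeakEquivalence {X Y : SSet.{u}} (f : X ⟶ Y) : Prop :=
  ∀ (K : SSet.{u}), SSet.KanComplex K →
    Function.Bijective (SSet.mapπ₀ ((MonoidalClosed.pre f).app K))

/-! ### Diagrams of spaces: mapping spaces and homotopy limits -/

section Diagrams

variable {D : Type} [SmallCategory D] {E : Type} [SmallCategory E]

/-- The mapping space `hom(A, B)` of two diagrams of spaces `A, B : D ⥤ SSet`: its `k`-simplices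
are the natural transformations `A × Δ[k] ⟶ B`. -/
def mapSpace (A B : D ⥤ SSet.{u}) : SSet.{u} where
  obj k := (A ⋙ tensorRight (SSet.stdSimplex.obj k.unop)) ⟶ B
  map θ := ↾fun φ ↦
    Functor.whiskerLeft A ((tensoringRight SSet.{u}).map (SSet.stdSimplex.map θ.unop)) ≫ φ
  map_id k := by
    refine ConcreteCategory.hom_ext _ _ fun φ ↦ ?_
    have h : SSet.stdSimplex.{u}.map (𝟙 k.unop) = 𝟙 _ := CategoryTheory.Functor.map_id _ _
    change Functor.whiskerLeft A ((tensoringRight SSet.{u}).map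
      (SSet.stdSimplex.map (𝟙 k.unop))) ≫ φ = φ
    rw [h, CategoryTheory.Functor.map_id]
    exact Category.id_comp φ
  map_comp θ θ' := by
    refine ConcreteCategory.hom_ext _ _ fun φ ↦ ?_
    have h : SSet.stdSimplex.{u}.map (θ'.unop ≫ θ.unop) =
      SSet.stdSimplex.map θ'.unop ≫ SSet.stdSimplex.map θ.unop :=
        CategoryTheory.Functor.map_comp _ _ _
    change Functor.whiskerLeft A ((tensoringRight SSet.{u}).map
      (SSet.stdSimplex.map (θ'.unop ≫ θ.unop))) ≫ φ = _
    rw [h, CategoryTheory.Functor.map_comp, Functor.whiskerLeft_comp, Category.assoc]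
    rfl

/-- Precomposition with `a : A' ⟶ A`, as a map of mapping spaces. -/
def mapSpacePre {A A' : D ⥤ SSet.{u}} (a : A' ⟶ A) (B : D ⥤ SSet.{u}) :
    mapSpace A B ⟶ mapSpace A' B where
  app k := ↾fun φ ↦ Functor.whiskerRight a (tensorRight (SSet.stdSimplex.obj k.unop)) ≫ φ
  naturality k l θ := by
    refine ConcreteCategory.hom_ext _ _ fun φ ↦ ?_
    apply NatTrans.ext
    funext d
    change a.app d ▷ _ ≫ _ ◁ SSet.stdSimplex.map θ.unop ≫ φ.app d =
      _ ◁ SSet.stdSimplex.map θ.unop ≫ a.app d ▷ _ ≫ φ.app d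
    rw [whisker_exchange_assoc]

/-- Postcomposition with `b : B ⟶ B'`, as a map of mapping spaces. -/
def mapSpacePost (A : D ⥤ SSet.{u}) {B B' : D ⥤ SSet.{u}} (b : B ⟶ B') :
    mapSpace A B ⟶ mapSpace A B' where
  app k := ↾fun φ ↦ φ ≫ b
  naturality k l θ := by
    refine ConcreteCategory.hom_ext _ _ fun φ ↦ ?_
    exact Category.assoc (Functor.whiskerLeft A ((tensoringRight SSet.{u}).map
      (SSet.stdSimplex.map θ.unop))) φ b

/-- Restriction of mapping spaces along a functor `F : E ⥤ D`. -/
def mapSpaceRestrict (F : E ⥤ D) (A B : D ⥤ SSet.{u}) :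
    mapSpace A B ⟶ mapSpace (F ⋙ A) (F ⋙ B) where
  app _ := ↾fun φ ↦ Functor.whiskerLeft F φ
  naturality _ _ _ := rfl

variable (D) in
/-- The diagram of spaces `N(D/•) : D ⥤ SSet`. Here `N` is the nerve (underlying space) with the
Bousfield--Kan orientation: the `m`-simplices of `N(C)` are the chains `c₀ ← c₁ ← ⋯ ← cₘ` in `C`,
so `N(C)` is the nerve of `Cᵒᵖ` in the orientation of Mathlib. -/
def overNerve : D ⥤ SSet.{u} :=
  Over.mapFunctor D ⋙ Cat.opFunctor ⋙ nerveFunctor ⋙ SSet.uliftFunctor.{u, 0}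

lemma over_map_comp_post (F : E ⥤ D) {e e' : E} (f : e ⟶ e') :
    Over.map f ⋙ Over.post F = Over.post F ⋙ Over.map (F.map f) := by
  refine CategoryTheory.Functor.ext (fun α ↦ ?_) (fun α β h ↦ ?_)
  · change Over.mk (F.map (α.hom ≫ f)) = Over.mk (F.map α.hom ≫ F.map f)
    rw [F.map_comp]
  · ext
    simp only [Over.comp_left, Over.eqToHom_left]
    change F.map h.left = eqToHom rfl ≫ F.map h.left ≫ eqToHom rfl
    simp

/-- The map of diagrams `N(E/•) ⟶ N(D/F(•))` induced by a functor `F : E ⥤ D`. -/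
def overNerveMap (F : E ⥤ D) : overNerve.{u} E ⟶ F ⋙ overNerve.{u} D where
  app e := SSet.uliftFunctor.{u, 0}.map (nerveMap (Over.post (X := e) F).op)
  naturality e e' f := by
    change SSet.uliftFunctor.{u, 0}.map (nerveMap (Over.map f ⋙ Over.post F).op) =
      SSet.uliftFunctor.{u, 0}.map (nerveMap (Over.post F ⋙ Over.map (F.map f)).op)
    rw [over_map_comp_post]

/-- The Bousfield--Kan homotopy limit `holim_D X = hom(N(D/•), X)`. -/
def holim (X : D ⥤ SSet.{u}) : SSet.{u} := mapSpace (overNerve D) X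

/-- The map `holim_D X ⟶ holim_D Y` induced by a map of diagrams. -/
def holimMap {X Y : D ⥤ SSet.{u}} (f : X ⟶ Y) : holim X ⟶ holim Y :=
  mapSpacePost (overNerve D) f

/-- The canonical map `holim_D X ⟶ holim_E (X ∘ F)` induced by a functor `F : E ⥤ D`. -/
def holimRestrict (F : E ⥤ D) (X : D ⥤ SSet.{u}) : holim X ⟶ holim (F ⋙ X) :=
  mapSpaceRestrict F (overNerve D) X ≫ mapSpacePre (overNerveMap F) (F ⋙ X)

/-- For `i : D ⥤ Δ`, the zeroth vertex map `z : N(D/d) ⟶ Δ[i d]`, sending a vertex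
`α : d' ⟶ d` of `N(D/d)` to the vertex `i(α)(0)` of `Δ[i d]`. -/
def zerothVertex (i : D ⥤ SimplexCategory) : overNerve.{u} D ⟶ i ⋙ SSet.stdSimplex.{u} where
  app d :=
    { app := fun k ↦ ↾fun c ↦ SSet.stdSimplex.objMk
        { toFun := fun j ↦ (i.map (c.down.obj j).unop.hom).toOrderHom 0
          monotone' := fun j j' h ↦ by
            have hw := Over.w (c.down.map (homOfLE h)).unop
            change (i.map (c.down.obj j).unop.hom).toOrderHom 0 ≤
              (i.map (c.down.obj j').unop.hom).toOrderHom 0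
            rw [← hw, i.map_comp]
            exact (i.map (c.down.obj j).unop.hom).toOrderHom.monotone (Fin.zero_le _) }
      naturality := fun k l θ ↦ by
        rfl }
  naturality d d' f := by
    apply NatTrans.ext
    funext k
    refine ConcreteCategory.hom_ext _ _ fun c ↦ ?_
    apply SSet.stdSimplex.objEquiv.injective
    apply SimplexCategory.Hom.ext
    apply OrderHom.ext
    funext j
    change (i.map ((c.down.obj j).unop.hom ≫ f)).toOrderHom 0 =
      (i.map f).toOrderHom ((i.map (c.down.obj j).unop.hom).toOrderHom 0)
    rw [i.map_comp]
    rfl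

end Diagrams

/-! ### Cosimplicial spaces: fibrancy, `Tot` and `Tot_n` -/

/-- The (Reedy) matching space `M^n Z` of a cosimplicial space `Z` at `[n]`: the limit of the
spaces `Z^p` over all surjections `σ : [n] ⟶ [p]` with `p < n`. -/
def matchingSpace (Z : SimplexCategory ⥤ SSet.{u}) (n : SimplexCategory) : SSet.{u} where
  obj k := { x : ∀ (p : SimplexCategory) (σ : n ⟶ p), Epi σ → p.len < n.len → (Z.obj p).obj k //
    ∀ (p q : SimplexCategory) (σ : n ⟶ p) (τ : p ⟶ q) (hσ : Epi σ) (hp : p.len < n.len)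
      (hστ : Epi (σ ≫ τ)) (hq : q.len < n.len),
      (Z.map τ).app k (x p σ hσ hp) = x q (σ ≫ τ) hστ hq }
  map θ := ↾fun x ↦ ⟨fun p σ hσ hp ↦ (Z.obj p).map θ (x.1 p σ hσ hp),
    fun p q σ τ hσ hp hστ hq ↦ by
      rw [NatTrans.naturality_apply, x.2 p q σ τ hσ hp hστ hq]⟩
  map_id k := by
    refine ConcreteCategory.hom_ext _ _ fun x ↦ ?_
    apply Subtype.ext
    funext p σ hσ hp
    simp
  map_comp θ θ' := by
    refine ConcreteCategory.hom_ext _ _ fun x ↦ ?_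
    apply Subtype.ext
    funext p σ hσ hp
    simp

/-- The matching map `Z^n ⟶ M^n Z`, with components the codegeneracies `Z(σ)`. -/
def matchingMap (Z : SimplexCategory ⥤ SSet.{u}) (n : SimplexCategory) :
    Z.obj n ⟶ matchingSpace Z n where
  app k := ↾fun z ↦ ⟨fun p σ _ _ ↦ (Z.map σ).app k z, fun p q σ τ _ _ _ _ ↦ by simp⟩
  naturality k l θ := by
    refine ConcreteCategory.hom_ext _ _ fun z ↦ ?_
    apply Subtype.ext
    funext p σ hσ hp
    exact NatTrans.naturality_apply (Z.map σ) θ z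

/-- A cosimplicial space is fibrant if all its matching maps are Kan fibrations (for `n = 0` this
says that `Z^0` is a Kan complex). -/
def IsFibrantCosimplicial (Z : SimplexCategory ⥤ SSet.{u}) : Prop :=
  ∀ n : SimplexCategory, Fibration (matchingMap Z n)

lemma skeleton_le_preimage {X Y : SSet.{u}} (f : X ⟶ Y) (n : ℕ) :
    X.skeleton n ≤ (Y.skeleton n).preimage f := by
  change (⨆ (i : Fin n) (x : X.nonDegenerate i), SSet.Subcomplex.ofSimplex x.1) ≤ _
  refine iSup_le fun i ↦ iSup_le fun x ↦ ?_
  rw [SSet.Subcomplex.ofSimplex_le_iff]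
  exact Y.mem_skeleton _ i.isLt

/-- The cosimplicial space `sk_n Δ`, with `sk_n Δ[q] ⊆ Δ[q]` the subspace generated by the
simplices of dimension at most `n`. (In Mathlib, `X.skeleton m` is generated by the simplices of
dimension `< m`.) -/
def skDelta (n : ℕ) : SimplexCategory ⥤ SSet.{u} where
  obj q := ((SSet.stdSimplex.{u}.obj q).skeleton (n + 1) : SSet.{u})
  map {q r} θ := SSet.Subcomplex.lift
    (((SSet.stdSimplex.{u}.obj q).skeleton (n + 1)).ι ≫ SSet.stdSimplex.map θ) (by
      rintro m _ ⟨⟨x, hx⟩, rfl⟩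
      exact skeleton_le_preimage (SSet.stdSimplex.map θ) (n + 1) m hx)
  map_id q := by
    rw [← cancel_mono (SSet.Subcomplex.ι _)]
    have h : SSet.stdSimplex.{u}.map (𝟙 q) = 𝟙 _ := CategoryTheory.Functor.map_id _ _
    change SSet.Subcomplex.ι _ ≫ SSet.stdSimplex.map (𝟙 q) = SSet.Subcomplex.ι _
    rw [h, Category.comp_id]
  map_comp {q r t} θ θ' := by
    rw [← cancel_mono (SSet.Subcomplex.ι _)]
    have h : SSet.stdSimplex.{u}.map (θ ≫ θ') =
      SSet.stdSimplex.map θ ≫ SSet.stdSimplex.map θ' := CategoryTheory.Functor.map_comp _ _ _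
    change SSet.Subcomplex.ι _ ≫ SSet.stdSimplex.map (θ ≫ θ') =
      SSet.Subcomplex.ι _ ≫ SSet.stdSimplex.map θ ≫ SSet.stdSimplex.map θ'
    rw [h]

/-- The inclusion `sk_n Δ ⟶ sk_m Δ` for `n ≤ m`. -/
def skDeltaIncl {n m : ℕ} (h : n ≤ m) : skDelta.{u} n ⟶ skDelta.{u} m where
  app q := SSet.Subcomplex.homOfLE
    ((SSet.stdSimplex.{u}.obj q).skeleton.monotone (Nat.succ_le_succ h))
  naturality _ _ _ := rfl

/-- The inclusion `sk_n Δ ⟶ Δ`. -/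
def skDeltaι (n : ℕ) : skDelta.{u} n ⟶ SSet.stdSimplex.{u} where
  app q := ((SSet.stdSimplex.{u}.obj q).skeleton (n + 1)).ι
  naturality _ _ _ := rfl

/-- `Tot Z = hom(Δ, Z)`. -/
def Tot (Z : SimplexCategory ⥤ SSet.{u}) : SSet.{u} := mapSpace SSet.stdSimplex.{u} Z

/-- `Tot_n Z = hom(sk_n Δ, Z)`. -/
def TotN (n : ℕ) (Z : SimplexCategory ⥤ SSet.{u}) : SSet.{u} := mapSpace (skDelta.{u} n) Z

/-- The map `Tot Z ⟶ Tot W` induced by `f : Z ⟶ W`. -/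
def totMap {Z W : SimplexCategory ⥤ SSet.{u}} (f : Z ⟶ W) : Tot Z ⟶ Tot W :=
  mapSpacePost SSet.stdSimplex.{u} f

/-- The map `Tot_n Z ⟶ Tot_n W` induced by `f : Z ⟶ W`. -/
def totNMap (n : ℕ) {Z W : SimplexCategory ⥤ SSet.{u}} (f : Z ⟶ W) : TotN n Z ⟶ TotN n W :=
  mapSpacePost (skDelta.{u} n) f

/-- The tower map `Tot_m Z ⟶ Tot_n Z` for `n ≤ m`, induced by `sk_n Δ ⊆ sk_m Δ`. -/
def totNRestrict {n m : ℕ} (h : n ≤ m) (Z : SimplexCategory ⥤ SSet.{u}) : TotN m Z ⟶ TotN n Z :=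
  mapSpacePre (skDeltaIncl h) Z

/-- The map `Tot Z ⟶ Tot_n Z` induced by `sk_n Δ ⊆ Δ`. -/
def totRestrict (n : ℕ) (Z : SimplexCategory ⥤ SSet.{u}) : Tot Z ⟶ TotN n Z :=
  mapSpacePre (skDeltaι n) Z

/-! ### Homotopy limits over `Δ` and `Δ^{<n+1}`

The category `Δ^{<n+1}`, the full subcategory of `Δ` on the `[q]` with `q < n + 1`, is
`SimplexCategory.Truncated n`, with inclusion `SimplexCategory.Truncated.inclusion n` into `Δ`. -/

/-- `holim_{Δ^{<n+1}} Z`, the homotopy limit of the restriction of `Z` to `Δ^{<n+1}`. -/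
def holimN (n : ℕ) (Z : SimplexCategory ⥤ SSet.{u}) : SSet.{u} :=
  holim (SimplexCategory.Truncated.inclusion n ⋙ Z)

/-- The map `holim_{Δ^{<n+1}} Z ⟶ holim_{Δ^{<n+1}} W` induced by `f : Z ⟶ W`. -/
def holimNMap (n : ℕ) {Z W : SimplexCategory ⥤ SSet.{u}} (f : Z ⟶ W) :
    holimN n Z ⟶ holimN n W :=
  holimMap (Functor.whiskerLeft (SimplexCategory.Truncated.inclusion n) f)

/-- The canonical map `holim_{Δ^{<m+1}} Z ⟶ holim_{Δ^{<n+1}} Z` for `n ≤ m`. -/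
def holimNRestrict {n m : ℕ} (h : n ≤ m) (Z : SimplexCategory ⥤ SSet.{u}) :
    holimN m Z ⟶ holimN n Z :=
  holimRestrict (SimplexCategory.Truncated.incl n m h)
    (SimplexCategory.Truncated.inclusion m ⋙ Z)

/-- The canonical map `holim_Δ Z ⟶ holim_{Δ^{<n+1}} Z`. -/
def holimNOfHolim (n : ℕ) (Z : SimplexCategory ⥤ SSet.{u}) : holim Z ⟶ holimN n Z :=
  holimRestrict (SimplexCategory.Truncated.inclusion n) Z

/-! ### The comparison maps `z^*` -/

lemma mem_skeleton_stdSimplex {q : SimplexCategory} {n : ℕ} (h : q.len < n)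
    {k : SimplexCategoryᵒᵖ} (x : (SSet.stdSimplex.{u}.obj q).obj k) :
    x ∈ ((SSet.stdSimplex.{u}.obj q).skeleton n).obj k := by
  have hx : (SSet.stdSimplex.{u}.obj q).map (SSet.stdSimplex.objEquiv x).op
      (SSet.stdSimplex.objEquiv.symm (𝟙 q)) = x :=
    SSet.stdSimplex.objEquiv.injective (Category.comp_id (SSet.stdSimplex.objEquiv x))
  rw [← hx]
  exact ((SSet.stdSimplex.{u}.obj q).skeleton n).map (SSet.stdSimplex.objEquiv x).op
    ((SSet.stdSimplex.{u}.obj q).mem_skeleton (SSet.stdSimplex.objEquiv.symm (𝟙 q)) h)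

/-- The zeroth vertex map `N(Δ^{<n+1}/[q]) ⟶ Δ[q] = sk_n Δ[q]`, for `[q]` in `Δ^{<n+1}`. -/
def zerothVertexN (n : ℕ) :
    overNerve.{u} (SimplexCategory.Truncated n) ⟶
      SimplexCategory.Truncated.inclusion n ⋙ skDelta.{u} n where
  app q := SSet.Subcomplex.lift
    ((zerothVertex (SimplexCategory.Truncated.inclusion n)).app q) (by
      rintro k _ ⟨c, rfl⟩
      exact mem_skeleton_stdSimplex (Nat.lt_succ_of_le q.property) _)
  naturality q r θ := by
    apply (cancel_mono ((SSet.stdSimplex.{u}.obj r.obj).skeleton (n + 1)).ι).1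
    exact (zerothVertex (SimplexCategory.Truncated.inclusion n)).naturality θ

/-- The Bousfield--Kan map `z^* : Tot Z = hom(Δ, Z) ⟶ hom(N(Δ/•), Z) = holim_Δ Z` induced by the
zeroth vertex map. -/
def totToHolim (Z : SimplexCategory ⥤ SSet.{u}) : Tot Z ⟶ holim Z :=
  mapSpacePre (zerothVertex (𝟭 SimplexCategory)) Z

/-- The map `z^* : Tot_n Z ⟶ holim_{Δ^{<n+1}} Z`: restrict along `i : Δ^{<n+1} ⥤ Δ`,
`hom(sk_n Δ, Z) ⟶ hom(i^* sk_n Δ, i^* Z) = hom(i^* Δ, i^* Z)`, and precompose with the zeroth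
vertex map `N(Δ^{<n+1}/•) ⟶ i^* Δ`. -/
def totNToHolimN (n : ℕ) (Z : SimplexCategory ⥤ SSet.{u}) : TotN n Z ⟶ holimN n Z :=
  mapSpaceRestrict (SimplexCategory.Truncated.inclusion n) (skDelta.{u} n) Z ≫
    mapSpacePre (zerothVertexN n) (SimplexCategory.Truncated.inclusion n ⋙ Z)

end CosimplicialSpace

end

/-!
The zeroth vertex map `z : N → Δ` is a map between pointwise contractible diagrams, but it is not
injective. Embedding `N` pointwise in a cofree diagram `R` factors it as `N → R × Δ → Δ`. The
projection induces a homotopy equivalence of mapping spaces, because the contraction of `R` onto its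
base point is natural. The first map is a pointwise monomorphism between contractible diagrams,
hence pointwise anodyne, and it induces a trivial fibration of mapping spaces: a map from a
pointwise anodyne pair of diagrams into a fibrant `Z` is extended by induction on `[q]`, where the
obstruction is a lifting problem of a relative latching map against the matching map of `Z`.

Relative latching maps are anodyne because a diagram over `Δ` behaves like a Reedy cofibrant one for
the codegeneracies: each simplex comes from a smallest face, which is found by minimising the total
distance to its zeroth vertex, so that the images of the faces of `[q]` intersect as the faces do.

For finite `n`, every simplex of `sk_n Δ[q]` is the image of one of `Δ[p]` with `p ≤ n` in an
essentially unique way, whence `hom(sk_n Δ, Z)` is a mapping space over `Δ^{<n+1}`.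
-/

noncomputable section

namespace CosimplicialSpace

/-! ### Anodyne extensions -/

open CartesianMonoidalCategory

lemma hom_ext_apply {X Y : SSet.{u}} {f g : X ⟶ Y} (h : ∀ k (x : X.obj k), f.app k x = g.app k x) :
    f = g :=
  NatTrans.ext (funext fun k ↦ ConcreteCategory.hom_ext _ _ (h k))

lemma app_congr {X Y : SSet.{u}} {f g : X ⟶ Y} (h : f = g) {k : SimplexCategoryᵒᵖ} (x : X.obj k) :
    f.app k x = g.app k x := by
  rw [h]

lemma exists_lift_tensor {A C K L E F : SSet.{u}} {i : A ⟶ C} {j : K ⟶ L}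
    (sq : (curriedTensor SSet.{u}).PushoutObjObj i j) {p : E ⟶ F} [HasLiftingProperty sq.ι p]
    {v : C ⊗ K ⟶ E} {w : A ⊗ L ⟶ E} {g : C ⊗ L ⟶ F} (hvw : i ▷ K ≫ v = A ◁ j ≫ w)
    (hv : v ≫ p = C ◁ j ≫ g) (hw : w ≫ p = i ▷ L ≫ g) :
    ∃ l : C ⊗ L ⟶ E, C ◁ j ≫ l = v ∧ i ▷ L ≫ l = w ∧ l ≫ p = g := by
  have comm : CommSq (sq.isPushout.desc v w hvw) sq.ι p g := by
    constructor
    apply sq.hom_ext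
    · simpa using hv
    · simpa using hw
  have hv : sq.inl ≫ sq.ι ≫ comm.lift = v := by rw [comm.fac_left, sq.isPushout.inl_desc]
  have hw : sq.inr ≫ sq.ι ≫ comm.lift = w := by rw [comm.fac_left, sq.isPushout.inr_desc]
  rw [sq.inl_ι_assoc] at hv
  rw [sq.inr_ι_assoc] at hw
  exact ⟨comm.lift, hv, hw, comm.fac_right⟩

section

variable {m : SimplexCategoryᵒᵖ}

lemma asOrderHom_eq_zero_of_mem_horn {t : Δ[1].obj m} (ht : t ∈ (SSet.horn.{u} 1 0).obj m)
    (j : Fin (m.unop.len + 1)) : SSet.stdSimplex.asOrderHom t j = 0 := by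
  by_contra hj
  refine ht (Set.eq_univ_of_forall fun y ↦ ?_)
  by_cases hy : y = 0
  · exact Or.inr hy
  · exact Or.inl ⟨j, by omega⟩

/-- The value at `0` of a simplex of the interval `Δ[1]`. -/
def intervalFirst (t : Δ[1].obj m) : Fin 2 := SSet.stdSimplex.asOrderHom.{u} t 0

lemma intervalFirst_map_of_mem_boundary {l : SimplexCategoryᵒᵖ} (θ : m ⟶ l) {t : Δ[1].obj m}
    (ht : t ∈ (SSet.boundary.{u} 1).obj m) :
    intervalFirst (Δ[1].map θ t) = intervalFirst t := by
  have hconst : ∀ j, SSet.stdSimplex.asOrderHom t j = SSet.stdSimplex.asOrderHom t 0 := by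
    intro j
    by_contra hj
    refine ht fun y ↦ ?_
    by_cases hy : y = SSet.stdSimplex.asOrderHom t 0
    · exact ⟨0, hy.symm⟩
    · exact ⟨j, by omega⟩
  exact hconst _

end

/-- The map on `X ⊗ ∂Δ[1]` with the given values at the two ends. -/
def boundaryDesc {X E : SSet.{u}} (f₀ f₁ : X ⟶ E) : X ⊗ (∂Δ[1] : SSet.{u}) ⟶ E where
  app k := ↾fun x ↦ if intervalFirst x.2.1 = 0 then f₀.app k x.1 else f₁.app k x.1
  naturality k l θ := by
    refine ConcreteCategory.hom_ext _ _ fun x ↦ ?_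
    have h := intervalFirst_map_of_mem_boundary θ x.2.2
    change (if intervalFirst (Δ[1].map θ x.2.1) = 0 then _ else _) = E.map θ (if _ then _ else _)
    rw [h]
    split_ifs
    · exact NatTrans.naturality_apply f₀ θ x.1
    · exact NatTrans.naturality_apply f₁ θ x.1

lemma exists_homotopy {A B E F : SSet.{u}} {i : A ⟶ B}
    (sq : (curriedTensor SSet.{u}).PushoutObjObj i (SSet.boundary.{u} 1).ι)
    {p : E ⟶ F} [HasLiftingProperty sq.ι p] {f₀ f₁ : B ⟶ E} (h : i ≫ f₀ = i ≫ f₁)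
    (h' : f₀ ≫ p = f₁ ≫ p) :
    ∃ H : B ⊗ Δ[1] ⟶ E, SSet.ι₀ ≫ H = f₀ ∧ SSet.ι₁ ≫ H = f₁ ∧
      i ▷ Δ[1] ≫ H = fst _ _ ≫ i ≫ f₀ ∧ H ≫ p = fst _ _ ≫ f₀ ≫ p := by
  have hvw : i ▷ _ ≫ boundaryDesc f₀ f₁ = A ◁ (SSet.boundary.{u} 1).ι ≫ fst _ _ ≫ i ≫ f₀ := by
    refine hom_ext_apply fun k x ↦ ?_
    change (if _ then f₀.app k (i.app k x.1) else f₁.app k (i.app k x.1)) = f₀.app k (i.app k x.1)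
    split_ifs
    · rfl
    · exact (app_congr h x.1).symm
  have hv : boundaryDesc f₀ f₁ ≫ p = B ◁ (SSet.boundary.{u} 1).ι ≫ fst _ _ ≫ f₀ ≫ p := by
    refine hom_ext_apply fun k x ↦ ?_
    change p.app k (if _ then f₀.app k x.1 else f₁.app k x.1) = p.app k (f₀.app k x.1)
    split_ifs
    · rfl
    · exact (app_congr h' x.1).symm
  obtain ⟨H, hv, hw, hg⟩ := exists_lift_tensor sq hvw hv rfl
  have hend (a : Fin 2) {k} (x : B.obj k) :
      H.app k (x, (SSet.const (SSet.stdSimplex.obj₀Equiv.symm a)).app k x) =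
        if a = 0 then f₀.app k x else f₁.app k x :=
    app_congr hv (x, (SSet.const (X := B) (Y := (∂Δ[1] : SSet.{u}))
      ⟨SSet.stdSimplex.obj₀Equiv.symm a, by rw [SSet.boundary_obj_eq_univ 0 1]; trivial⟩).app k x)
  exact ⟨H, hom_ext_apply fun k x ↦ hend 0 x, hom_ext_apply fun k x ↦ hend 1 x, hw, hg⟩

lemma tensor_horn_ι (X : SSet.{u}) :
    X ◁ (SSet.horn.{u} 1 0).ι = fst X (SSet.horn.{u} 1 0 : SSet.{u}) ≫ SSet.ι₀ := by
  refine hom_ext_apply fun k x ↦ Prod.ext rfl ?_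
  apply SSet.stdSimplex.objEquiv.injective
  apply SimplexCategory.Hom.ext
  apply OrderHom.ext
  funext j
  exact asOrderHom_eq_zero_of_mem_horn x.2.2 j

lemma exists_homotopy_extension {A B E F : SSet.{u}} (i : A ⟶ B) [Mono i] (p : E ⟶ F) [Fibration p]
    {f : B ⟶ E} {H : A ⊗ Δ[1] ⟶ E} {K : B ⊗ Δ[1] ⟶ F} (hH : SSet.ι₀ ≫ H = i ≫ f)
    (hK : SSet.ι₀ ≫ K = f ≫ p) (hHK : H ≫ p = i ▷ Δ[1] ≫ K) :
    ∃ L : B ⊗ Δ[1] ⟶ E, SSet.ι₀ ≫ L = f ∧ i ▷ Δ[1] ≫ L = H ∧ L ≫ p = K := by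
  let sq := Functor.PushoutObjObj.ofHasPushout (curriedTensor SSet.{u}) i (SSet.horn.{u} 1 0).ι
  have : HasLiftingProperty sq.ι p :=
    SSet.anodyneExtensions_pushoutObjObjι sq (.horn_ι 0) p (mem_fibrations p)
  obtain ⟨L, hv, hw, hg⟩ := exists_lift_tensor sq (p := p) (v := fst _ _ ≫ f) (w := H) (g := K)
    (by rw [tensor_horn_ι, Category.assoc, hH]; rfl)
    (by rw [tensor_horn_ι, Category.assoc, Category.assoc, hK]) hHK
  refine ⟨L, hom_ext_apply fun k x ↦ ?_, hw, hg⟩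
  exact app_congr hv (x, (SSet.const (X := B) (Y := (SSet.horn.{u} 1 0 : SSet.{u}))
    ⟨SSet.stdSimplex.obj₀Equiv.symm 0, fun h ↦ by
      obtain ⟨_, hj⟩ | h1 := Set.eq_univ_iff_forall.1 h 1
      · exact absurd (show (0 : Fin 2) = 1 from hj) (by decide)
      · exact absurd (show (1 : Fin 2) = 0 from h1) (by decide)⟩).app k x)

lemma anodyneExtensions_of_precomp {A B C : SSet.{u}} (f : A ⟶ B) (g : B ⟶ C) [Mono g]
    (hf : SSet.anodyneExtensions f) (hfg : SSet.anodyneExtensions (f ≫ g)) :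
    SSet.anodyneExtensions g := by
  intro E F p hp
  have : Fibration p := (fibration_iff p).2 hp
  refine ⟨fun {b c} sq ↦ ?_⟩
  let sqB := Functor.PushoutObjObj.ofHasPushout (curriedTensor SSet.{u}) f (SSet.boundary.{u} 1).ι
  have : HasLiftingProperty (f ≫ g) p := hfg p hp
  have : HasLiftingProperty sqB.ι p := SSet.anodyneExtensions_pushoutObjObjι' sqB hf p hp
  have sqC : CommSq (f ≫ b) (f ≫ g) p c := ⟨by rw [Category.assoc, sq.w, Category.assoc]⟩
  have hgl : (g ≫ sqC.lift) ≫ p = b ≫ p := by rw [Category.assoc, sqC.fac_right, sq.w]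
  obtain ⟨H, H₀, H₁, -, Hp⟩ := exists_homotopy sqB (p := p) (f₀ := g ≫ sqC.lift) (f₁ := b)
    (by rw [← Category.assoc, sqC.fac_left]) hgl
  obtain ⟨L, -, Lg, Lp⟩ := exists_homotopy_extension g p (f := sqC.lift) (H := H)
    (K := fst _ _ ≫ c) H₀ (by rw [sqC.fac_right]; rfl)
    (by rw [Hp, hgl, sq.w]; rfl)
  refine ⟨⟨⟨SSet.ι₁ ≫ L, ?_, ?_⟩⟩⟩
  · rw [← H₁, ← Lg]
    rfl
  · rw [Category.assoc, Lp]
    rfl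

/-! ### Contractions -/

lemma exists_eq_const {X : SSet.{u}} (e : Δ[0] ⟶ X) : ∃ v : X _⦋0⦌, e = SSet.const v :=
  ⟨e.app _ (SSet.stdSimplex.obj₀Equiv.symm 0), by
    rw [← SSet.const_comp (X := Δ[0]), SSet.stdSimplex.isTerminalObj₀.hom_ext (SSet.const _) (𝟙 _),
      Category.id_comp]⟩

lemma const_app_vertex {X Y : SSet.{u}} (v : Y _⦋0⦌) (x : X _⦋0⦌) :
    (SSet.const v : X ⟶ Y).app _ x = v := by
  have h : ⦋0⦌.const ⦋0⦌ 0 = 𝟙 _ := SimplexCategory.isTerminalZero.hom_ext _ _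
  change Y.map (⦋0⦌.const ⦋0⦌ 0).op v = v
  rw [h]
  exact Y.map_id_apply _ v

/-- A simplicial contraction of `X` onto the vertex `v`, keeping `v` fixed. -/
structure Contraction {X : SSet.{u}} (v : X _⦋0⦌) where
  homotopy : X ⊗ Δ[1] ⟶ X
  ι₀_homotopy : SSet.ι₀ ≫ homotopy = SSet.const v
  ι₁_homotopy : SSet.ι₁ ≫ homotopy = 𝟙 X
  const_homotopy : (SSet.const v : Δ[0] ⟶ X) ▷ Δ[1] ≫ homotopy = SSet.const v

namespace Contraction

variable {X Y : SSet.{u}} {v : X _⦋0⦌} {w : Y _⦋0⦌}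

lemma anodyneExtensions (c : Contraction v) :
    SSet.anodyneExtensions (SSet.const v : Δ[0] ⟶ X) := by
  intro E F p hp
  have : Fibration p := (fibration_iff p).2 hp
  have : Mono (SSet.const v : Δ[0] ⟶ X) := SSet.stdSimplex.isTerminalObj₀.mono_from _
  refine ⟨fun {e f} sq ↦ ?_⟩
  obtain ⟨a, rfl⟩ := exists_eq_const e
  have hpa : p.app _ a = f.app _ v := by
    have h := app_congr sq.w (SSet.stdSimplex.obj₀Equiv.symm 0)
    rwa [SSet.const_comp, SSet.const_comp, const_app_vertex, const_app_vertex] at h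
  obtain ⟨L, -, Lv, Lp⟩ := exists_homotopy_extension (SSet.const v : Δ[0] ⟶ X) p
    (f := SSet.const a) (H := SSet.const a) (K := c.homotopy ≫ f) rfl
    (by rw [← Category.assoc, c.ι₀_homotopy, SSet.const_comp, SSet.const_comp, hpa])
    (by rw [← Category.assoc, c.const_homotopy, SSet.const_comp, SSet.const_comp, hpa])
  refine ⟨⟨⟨SSet.ι₁ ≫ L, ?_, ?_⟩⟩⟩
  · change SSet.ι₁ ≫ SSet.const v ▷ Δ[1] ≫ L = _
    rw [Lv]
    rfl
  · rw [Category.assoc, Lp, ← Category.assoc, c.ι₁_homotopy, Category.id_comp]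

lemma anodyneExtensions_of_mono (c : Contraction v) (f : X ⟶ Y) [Mono f]
    (c' : Contraction (f.app _ v)) : SSet.anodyneExtensions f :=
  anodyneExtensions_of_precomp (SSet.const v) f c.anodyneExtensions (by
    rw [SSet.const_comp]
    exact c'.anodyneExtensions)

/-- The product of two contractions. -/
def tensor (c : Contraction v) (c' : Contraction w) : Contraction (X := X ⊗ Y) (v, w) where
  homotopy := lift (fst _ _ ▷ _ ≫ c.homotopy) (snd _ _ ▷ _ ≫ c'.homotopy)
  ι₀_homotopy := hom_ext_apply fun _ x ↦
    Prod.ext (app_congr c.ι₀_homotopy x.1) (app_congr c'.ι₀_homotopy x.2)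
  ι₁_homotopy := hom_ext_apply fun _ x ↦
    Prod.ext (app_congr c.ι₁_homotopy x.1) (app_congr c'.ι₁_homotopy x.2)
  const_homotopy := hom_ext_apply fun _ x ↦
    Prod.ext (app_congr c.const_homotopy x) (app_congr c'.const_homotopy x)

end Contraction

/-! ### Covers by subcomplexes -/

section

variable {X : SSet.{u}} {A B C : X.Subcomplex}

/-- The subcomplex `A` is contained in `B`, and its inclusion in `B` is an anodyne extension. -/
def IsAnodyneIn (A B : X.Subcomplex) : Prop :=
  ∃ h : A ≤ B, SSet.anodyneExtensions (SSet.Subcomplex.homOfLE h)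

lemma IsAnodyneIn.of_ge (h : A ≤ B) (h' : B ≤ A) :
    IsAnodyneIn A B := by
  obtain rfl := h.antisymm h'
  exact ⟨le_rfl, .of_isIso (𝟙 _)⟩

lemma IsAnodyneIn.sup (h : IsAnodyneIn (A ⊓ B) B) : IsAnodyneIn A (A ⊔ B) :=
  ⟨le_sup_left, SSet.anodyneExtensions.of_isPushout
    (SSet.Subcomplex.BicartSq.isPushout ⟨rfl, rfl⟩) h.2⟩

lemma IsAnodyneIn.of_trans (h : IsAnodyneIn A B) (h' : IsAnodyneIn A C) (hBC : B ≤ C) :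
    IsAnodyneIn B C :=
  ⟨hBC, anodyneExtensions_of_precomp _ _ h.2 h'.2⟩

lemma isAnodyneIn_sup_iSup_erase {V : Type*} [DecidableEq V] {F : Finset V → X.Subcomplex}
    (hF : ∀ S T, F (S ∩ T) = F S ⊓ F T) (hA : ∀ T, IsAnodyneIn (A ⊓ F T) (F T)) (W T : Finset V) :
    IsAnodyneIn (A ⊓ F T ⊔ ⨆ w ∈ W, F (T.erase w)) (F T) := by
  have hle (T : Finset V) (w : V) : F (T.erase w) ≤ F T := by
    rw [← Finset.inter_eq_left.2 (T.erase_subset w), hF]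
    exact inf_le_right
  induction W using Finset.induction_on generalizing T with
  | empty => simpa using hA T
  | insert v W _ ih =>
    have hinf : (A ⊓ F T ⊔ ⨆ w ∈ W, F (T.erase w)) ⊓ F (T.erase v) =
        A ⊓ F (T.erase v) ⊔ ⨆ w ∈ W, F ((T.erase v).erase w) := by
      have herase (w : V) : F ((T.erase v).erase w) = F (T.erase w) ⊓ F (T.erase v) := by
        rw [← hF]
        congr 1
        grind
      ext k x
      have hmem := @hle T v k x
      simp only [Subfunctor.min_obj, Subfunctor.max_obj, Subfunctor.iSup_obj, Set.mem_inter_iff,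
        Set.mem_union, Set.mem_iUnion, exists_prop, herase]
      tauto
    have hsup : (A ⊓ F T ⊔ ⨆ w ∈ W, F (T.erase w)) ⊔ F (T.erase v) =
        A ⊓ F T ⊔ ⨆ w ∈ insert v W, F (T.erase w) := by
      rw [Finset.iSup_insert, sup_assoc, sup_comm (F (T.erase v))]
    have hstep : IsAnodyneIn (A ⊓ F T ⊔ ⨆ w ∈ W, F (T.erase w))
        (A ⊓ F T ⊔ ⨆ w ∈ insert v W, F (T.erase w)) := by
      rw [← hsup]
      exact IsAnodyneIn.sup (by rw [hinf]; exact ih _)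
    exact hstep.of_trans (ih T) (sup_le inf_le_right (iSup₂_le fun w _ ↦ hle T w))

end

/-! ### Minimal faces -/

lemma exists_pseudoInverse {α β : Type*} [LinearOrder α] [Finite α] [LinearOrder β]
    (f : α →o β) (a₀ : α) :
    ∃ s : β →o α, (∀ a, f (s (f a)) = f a) ∧ ∀ b, f (s b) ∈ Set.uIcc b (f a₀) := by
  cases nonempty_fintype α
  have hlow (b : β) (hb : b ≤ f a₀) : (Finset.univ.filter (b ≤ f ·)).Nonempty := ⟨a₀, by simpa⟩
  have hhigh (b : β) (hb : ¬ b ≤ f a₀) : (Finset.univ.filter (f · ≤ b)).Nonempty :=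
    ⟨a₀, by simpa using (not_le.1 hb).le⟩
  let s (b : β) : α := if hb : b ≤ f a₀ then (Finset.univ.filter (b ≤ f ·)).min' (hlow b hb)
    else (Finset.univ.filter (f · ≤ b)).max' (hhigh b hb)
  have s_le {b : β} {a : α} (hb : b ≤ f a₀) (ha : b ≤ f a) : s b ≤ a := by
    simp only [s, dif_pos hb]
    exact Finset.min'_le _ _ (by simpa)
  have le_f_s {b : β} (hb : b ≤ f a₀) : b ≤ f (s b) := by
    simp only [s, dif_pos hb]
    simpa using Finset.min'_mem _ (hlow b hb)
  have le_s {b : β} {a : α} (hb : ¬ b ≤ f a₀) (ha : f a ≤ b) : a ≤ s b := by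
    simp only [s, dif_neg hb]
    exact Finset.le_max' _ _ (by simpa)
  have f_s_le {b : β} (hb : ¬ b ≤ f a₀) : f (s b) ≤ b := by
    simp only [s, dif_neg hb]
    simpa using Finset.max'_mem _ (hhigh b hb)
  refine ⟨⟨s, fun b b' h ↦ ?_⟩, fun a ↦ ?_, fun b ↦ ?_⟩
  · by_cases hb : b ≤ f a₀ <;> by_cases hb' : b' ≤ f a₀
    · exact s_le hb (h.trans (le_f_s hb'))
    · exact (s_le hb hb).trans (le_s hb' (not_le.1 hb').le)
    · exact absurd (h.trans hb') hb
    · exact le_s hb' ((f_s_le hb).trans h)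
  · by_cases ha : f a ≤ f a₀
    · exact (f.monotone (s_le ha le_rfl)).antisymm (le_f_s ha)
    · exact (f_s_le ha).antisymm (f.monotone (le_s ha le_rfl))
  · by_cases hb : b ≤ f a₀
    · exact Set.mem_uIcc.2 (Or.inl ⟨le_f_s hb, f.monotone (s_le hb hb)⟩)
    · exact Set.mem_uIcc.2 (Or.inr ⟨f.monotone (le_s hb (not_le.1 hb).le), f_s_le hb⟩)

section

variable {D : Type} [SmallCategory D]

/-- The functor `i` identifies `D` with a full subcategory of `Δ` which is an initial segment. -/
structure IsInitialSegment (i : D ⥤ SimplexCategory) : Prop where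
  full : i.Full
  faithful : i.Faithful
  obj_injective : Function.Injective i.obj
  exists_obj_eq (d : D) (p : SimplexCategory) (h : p.len ≤ (i.obj d).len) : ∃ e, i.obj e = p

lemma map_comp_app_apply (P : D ⥤ SSet.{u}) {a b c : D} (f : a ⟶ b) (g : b ⟶ c) {k}
    (x : (P.obj a).obj k) : (P.map (f ≫ g)).app k x = (P.map g).app k ((P.map f).app k x) := by
  rw [P.map_comp]
  rfl

variable {i : D ⥤ SimplexCategory} {P Q : D ⥤ SSet.{u}}

lemma map_app_app_apply (j : Q ⟶ P) {d e : D} (f : d ⟶ e) {k} (q : (Q.obj d).obj k) :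
    (P.map f).app k ((j.app d).app k q) = (j.app e).app k ((Q.map f).app k q) :=
  (app_congr (j.naturality f) q).symm

/-- The first vertex of the image of a simplex of `P` in the standard cosimplicial space. -/
def baseVertex (t : P ⟶ i ⋙ SSet.stdSimplex.{u}) {d : D} {k} (x : (P.obj d).obj k) :
    Fin ((i.obj d).len + 1) :=
  (SSet.stdSimplex.objEquiv ((t.app d).app k x)).toOrderHom 0

lemma baseVertex_map (t : P ⟶ i ⋙ SSet.stdSimplex.{u}) {e d : D} (f : e ⟶ d) {k}
    (y : (P.obj e).obj k) :
    baseVertex t ((P.map f).app k y) = (i.map f).toOrderHom (baseVertex t y) := by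
  have h := app_congr (t.naturality f) y
  exact congrArg (fun z ↦ (SSet.stdSimplex.objEquiv z).toOrderHom 0) h

lemma IsInitialSegment.exists_pseudoInverse (hi : IsInitialSegment i) {e d : D} (f : e ⟶ d)
    (a₀ : Fin ((i.obj e).len + 1)) :
    ∃ s : d ⟶ e, f ≫ s ≫ f = f ∧ ∀ b, (i.map (s ≫ f)).toOrderHom b ∈
      Set.uIcc b ((i.map f).toOrderHom a₀) := by
  have := hi.full
  have := hi.faithful
  obtain ⟨s, hs, hs'⟩ := CosimplicialSpace.exists_pseudoInverse (i.map f).toOrderHom a₀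
  refine ⟨i.preimage (SimplexCategory.Hom.mk s), i.map_injective ?_, fun b ↦ ?_⟩
  · rw [i.map_comp, i.map_comp, i.map_preimage]
    ext a : 3
    exact hs a
  · rw [i.map_comp, i.map_preimage]
    exact hs' b

/-- Among the endomorphisms fixing `x`, `ρ` minimises the total distance to the base vertex of `x`,
and rounding towards that vertex does not increase this distance. -/
lemma exists_minimal_endomorphism (hi : IsInitialSegment i) (t : P ⟶ i ⋙ SSet.stdSimplex.{u})
    {d : D} {k} (x : (P.obj d).obj k) :
    ∃ ρ : d ⟶ d, (P.map ρ).app k x = x ∧ ∀ (e : D) (f : e ⟶ d) (y : (P.obj e).obj k),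
      (P.map f).app k y = x → ∃ s : d ⟶ e, f ≫ s ≫ f = f ∧ ρ ≫ s ≫ f = ρ := by
  have := hi.faithful
  let v := baseVertex t x
  have closer {a b : Fin ((i.obj d).len + 1)} (h : b ∈ Set.uIcc a v) :
      Nat.dist b v ≤ Nat.dist a v ∧ (Nat.dist b v = Nat.dist a v → b = a) := by
    rw [Set.mem_uIcc, Fin.le_def, Fin.le_def, Fin.le_def, Fin.le_def] at h
    rw [Nat.dist, Nat.dist, Fin.ext_iff]
    omega
  let weight (ρ : d ⟶ d) : ℕ := ∑ j, Nat.dist ((i.map ρ).toOrderHom j) v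
  obtain ⟨ρ, hρ, hmin⟩ := exists_minimalFor_of_wellFoundedLT
    (fun ρ : d ⟶ d ↦ (P.map ρ).app k x = x) weight ⟨𝟙 d, by rw [P.map_id]; rfl⟩
  refine ⟨ρ, hρ, fun e f y hy ↦ ?_⟩
  obtain ⟨s, hs, hs'⟩ := hi.exists_pseudoInverse f (baseVertex t y)
  rw [← baseVertex_map, hy] at hs'
  refine ⟨s, hs, i.map_injective ?_⟩
  have hfix : (P.map (ρ ≫ s ≫ f)).app k x = x := by
    rw [map_comp_app_apply, hρ, ← hy, ← map_comp_app_apply, hs]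
  have hcloser (j) := closer (hs' ((i.map ρ).toOrderHom j))
  have hle : weight (ρ ≫ s ≫ f) ≤ weight ρ :=
    Finset.sum_le_sum fun j _ ↦ by
      rw [i.map_comp ρ]
      exact (hcloser j).1
  have heq := (Finset.sum_eq_sum_iff_of_le fun j _ ↦ (hcloser j).1).1 (by
    refine Eq.trans ?_ (hle.antisymm (hmin hfix hle))
    simp only [weight, i.map_comp ρ]
    rfl)
  rw [i.map_comp]
  ext j : 3
  exact (hcloser j).2 (heq j (Finset.mem_univ j))

end

/-! ### Relative latching objects -/

section

variable {D : Type} [SmallCategory D] {i : D ⥤ SimplexCategory} {P Q : D ⥤ SSet.{u}}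

/-- The subcomplex of `P.obj d` of the simplices which come from an object of `D` whose image in
`[len d]` is contained in the set of vertices `T`. -/
def face (i : D ⥤ SimplexCategory) (P : D ⥤ SSet.{u}) (d : D)
    (T : Finset (Fin ((i.obj d).len + 1))) : (P.obj d).Subcomplex where
  obj k := {x | ∃ (e : D) (f : e ⟶ d), (∀ a, (i.map f).toOrderHom a ∈ T) ∧
    ∃ y, (P.map f).app k y = x}
  map θ x := by
    rintro ⟨e, f, hf, y, rfl⟩
    exact ⟨e, f, hf, _, NatTrans.naturality_apply (P.map f) θ y⟩

lemma face_inter (hi : IsInitialSegment i) (t : P ⟶ i ⋙ SSet.stdSimplex.{u}) {d : D}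
    (S T : Finset (Fin ((i.obj d).len + 1))) :
    face i P d (S ∩ T) = face i P d S ⊓ face i P d T := by
  apply le_antisymm
  · rintro k x ⟨e, f, hf, hx⟩
    exact ⟨⟨e, f, fun a ↦ Finset.mem_of_mem_inter_left (hf a), hx⟩,
      e, f, fun a ↦ Finset.mem_of_mem_inter_right (hf a), hx⟩
  · rintro k x ⟨⟨e, f, hf, y, hy⟩, e', f', hf', y', hy'⟩
    obtain ⟨ρ, hρ, hmin⟩ := exists_minimal_endomorphism hi t x
    have hmem {c : D} {g : c ⟶ d} {U : Finset (Fin ((i.obj d).len + 1))}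
        (hg : ∀ a, (i.map g).toOrderHom a ∈ U) {z} (hz : (P.map g).app k z = x) (a) :
        (i.map ρ).toOrderHom a ∈ U := by
      obtain ⟨s, -, hs⟩ := hmin c g z hz
      rw [← hs, ← Category.assoc, i.map_comp]
      exact hg _
    exact ⟨d, ρ, fun a ↦ Finset.mem_inter.2 ⟨hmem hf hy a, hmem hf' hy' a⟩, x, hρ⟩

lemma IsInitialSegment.exists_retraction (hi : IsInitialSegment i) {d : D}
    {T : Finset (Fin ((i.obj d).len + 1))} (hT : T.Nonempty) :
    ∃ (c : D) (m : c ⟶ d) (r : d ⟶ c), (i.obj c).len + 1 = T.card ∧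
      (∀ a, (i.map m).toOrderHom a ∈ T) ∧
      ∀ (e : D) (f : e ⟶ d), (∀ a, (i.map f).toOrderHom a ∈ T) → f ≫ r ≫ m = f := by
  have := hi.full
  have := hi.faithful
  obtain ⟨c, hc⟩ := hi.exists_obj_eq d ⦋T.card - 1⦌ (by
    have := T.card_le_univ
    rw [Fintype.card_fin] at this
    change T.card - 1 ≤ _
    omega)
  have hcard : T.card = (i.obj c).len + 1 := by
    have hlen : (i.obj c).len = T.card - 1 := congrArg SimplexCategory.len hc
    have := hT.card_pos
    omega
  let inc := T.orderEmbOfFin hcard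
  obtain ⟨r, hr, -⟩ := CosimplicialSpace.exists_pseudoInverse inc.toOrderHom 0
  have hinc (b) (hb : b ∈ T) : inc (r b) = b := by
    obtain ⟨a, rfl⟩ : b ∈ Set.range inc := by
      rwa [Finset.range_orderEmbOfFin, Finset.mem_coe]
    exact hr a
  refine ⟨c, i.preimage (SimplexCategory.Hom.mk inc.toOrderHom),
    i.preimage (SimplexCategory.Hom.mk r), hcard.symm, fun a ↦ ?_, fun e f hf ↦ i.map_injective ?_⟩
  · rw [i.map_preimage]
    exact T.orderEmbOfFin_mem hcard a
  · rw [i.map_comp, i.map_comp, i.map_preimage, i.map_preimage]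
    ext a : 3
    exact hinc _ (hf a)

/-- The inclusion is a retract of `j.app c` as soon as `P.map (r ≫ m)` fixes `B`. -/
lemma isAnodyneIn_range_inf (j : Q ⟶ P) {c d : D} [Mono (j.app d)]
    (hj : SSet.anodyneExtensions (j.app c)) {m : c ⟶ d} {r : d ⟶ c} {B : (P.obj d).Subcomplex}
    (hm : SSet.Subcomplex.range (P.map m) ≤ B)
    (hB : ∀ k, ∀ x ∈ B.obj k, (P.map (r ≫ m)).app k x = x) :
    IsAnodyneIn (SSet.Subcomplex.range (j.app d) ⊓ B) B := by
  let toQ : ((SSet.Subcomplex.range (j.app d) ⊓ B : (P.obj d).Subcomplex) : SSet.{u}) ⟶ Q.obj d :=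
    SSet.Subcomplex.homOfLE inf_le_left ≫ inv (SSet.Subcomplex.toRange (j.app d))
  have toQ_j : toQ ≫ j.app d = (SSet.Subcomplex.range (j.app d) ⊓ B).ι := by
    have h := SSet.Subcomplex.toRange_ι (j.app d)
    rw [← IsIso.eq_inv_comp] at h
    rw [Category.assoc, ← h]
    rfl
  have toQ_j_apply {k} (x) : (j.app d).app k (toQ.app k x) = x.1 := app_congr toQ_j x
  have hBm (k) (y) : (P.map m).app k y ∈ B.obj k := hm k ⟨y, rfl⟩
  let fromQ : Q.obj c ⟶ (SSet.Subcomplex.range (j.app d) ⊓ B : (P.obj d).Subcomplex) :=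
    SSet.Subcomplex.lift (Q.map m ≫ j.app d) (by
      rintro k _ ⟨y, rfl⟩
      refine ⟨⟨_, rfl⟩, ?_⟩
      exact map_app_app_apply j m y ▸ hBm k _)
  let fromP : P.obj c ⟶ B := SSet.Subcomplex.lift (P.map m) (by
    rintro k _ ⟨y, rfl⟩
    exact hBm k y)
  refine ⟨inf_le_right, MorphismProperty.of_retract (f := SSet.Subcomplex.homOfLE inf_le_right)
    (g := j.app c) ⟨Arrow.homMk (toQ ≫ Q.map r) (B.ι ≫ P.map r) ?_,
      Arrow.homMk fromQ fromP ?_, ?_⟩ hj⟩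
  · refine hom_ext_apply fun k x ↦ ?_
    change (j.app c).app k ((Q.map r).app k (toQ.app k x)) = _
    rw [← map_app_app_apply, toQ_j_apply]
    rfl
  · refine hom_ext_apply fun k x ↦ Subtype.ext ?_
    exact (map_app_app_apply j m x).symm
  · apply Arrow.hom_ext
    · refine hom_ext_apply fun k x ↦ Subtype.ext ?_
      change (j.app d).app k ((Q.map m).app k ((Q.map r).app k (toQ.app k x))) = x.1
      rw [← map_comp_app_apply, ← map_app_app_apply, toQ_j_apply, hB k _ x.2.2]
    · refine hom_ext_apply fun k x ↦ Subtype.ext ?_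
      exact (map_comp_app_apply P r m x.1).symm.trans (hB k x.1 x.2)

/-- The union of the image of `j` and of the simplices of `P.obj d` which come from objects
of smaller degree. -/
def relativeLatching (i : D ⥤ SimplexCategory) (j : Q ⟶ P) (d : D) : (P.obj d).Subcomplex where
  obj k := {x | (∃ q, (j.app d).app k q = x) ∨ ∃ (e : D) (f : e ⟶ d) (y : (P.obj e).obj k),
    (i.obj e).len < (i.obj d).len ∧ (P.map f).app k y = x}
  map θ x := by
    rintro (⟨q, rfl⟩ | ⟨e, f, y, he, rfl⟩)
    · exact Or.inl ⟨_, NatTrans.naturality_apply (j.app d) θ q⟩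
    · exact Or.inr ⟨e, f, _, he, NatTrans.naturality_apply (P.map f) θ y⟩

lemma relativeLatching_eq (hi : IsInitialSegment i) (j : Q ⟶ P) (d : D) :
    relativeLatching i j d = SSet.Subcomplex.range (j.app d) ⊔
      ⨆ w ∈ Finset.univ, face i P d (Finset.univ.erase w) := by
  ext k x
  simp only [Subfunctor.max_obj, Subfunctor.iSup_obj, Set.mem_union, Set.mem_iUnion]
  refine or_congr Iff.rfl ⟨?_, ?_⟩
  · rintro ⟨e, f, y, he, hy⟩
    obtain ⟨w, hw⟩ : ∃ w, ∀ a, (i.map f).toOrderHom a ≠ w := by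
      by_contra! h
      have := Fintype.card_le_of_surjective _ h
      simp only [Fintype.card_fin] at this
      omega
    exact ⟨w, Finset.mem_univ w, e, f, fun a ↦ Finset.mem_erase.2 ⟨hw a, Finset.mem_univ _⟩, y, hy⟩
  · rintro ⟨w, -, e, f, hf, y, hy⟩
    obtain ⟨c, m, r, hc, -, hfix⟩ := hi.exists_retraction (T := Finset.univ.erase w) ⟨_, hf 0⟩
    rw [Finset.card_erase_of_mem (Finset.mem_univ w), Finset.card_univ, Fintype.card_fin] at hc
    refine ⟨c, m, (P.map (f ≫ r)).app k y, by omega, ?_⟩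
    rw [← map_comp_app_apply, Category.assoc, hfix e f hf, hy]

lemma isAnodyneIn_range_inf_face (hi : IsInitialSegment i) (j : Q ⟶ P) [∀ d, Mono (j.app d)]
    (hj : ∀ d, SSet.anodyneExtensions (j.app d)) (d : D) (T : Finset (Fin ((i.obj d).len + 1))) :
    IsAnodyneIn (SSet.Subcomplex.range (j.app d) ⊓ face i P d T) (face i P d T) := by
  obtain rfl | hT := T.eq_empty_or_nonempty
  · refine .of_ge inf_le_right ?_
    rintro k x ⟨e, f, hf, -⟩
    exact absurd (hf 0) (Finset.notMem_empty _)
  · obtain ⟨c, m, r, -, hm, hfix⟩ := hi.exists_retraction hT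
    refine isAnodyneIn_range_inf j (hj c) (m := m) (r := r) ?_ ?_
    · rintro k _ ⟨y, rfl⟩
      exact ⟨c, m, hm, y, rfl⟩
    · rintro k _ ⟨e, f, hf, y, rfl⟩
      rw [← map_comp_app_apply, hfix e f hf]

lemma anodyneExtensions_relativeLatching (hi : IsInitialSegment i) (t : P ⟶ i ⋙ SSet.stdSimplex.{u})
    (j : Q ⟶ P) [∀ d, Mono (j.app d)] (hj : ∀ d, SSet.anodyneExtensions (j.app d)) (d : D) :
    SSet.anodyneExtensions (relativeLatching i j d).ι := by
  have h := isAnodyneIn_sup_iSup_erase (face_inter hi t) (isAnodyneIn_range_inf_face hi j hj d)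
    Finset.univ Finset.univ
  have htop : face i P d Finset.univ = ⊤ :=
    top_le_iff.1 fun k x _ ↦ ⟨d, 𝟙 d, fun _ ↦ Finset.mem_univ _, x, by rw [P.map_id]; rfl⟩
  rw [htop, inf_top_eq, ← relativeLatching_eq hi] at h
  exact SSet.anodyneExtensions.comp_mem _ _ h.2 (.of_isIso (SSet.Subcomplex.topIso _).hom)

end

/-! ### Extension of maps to fibrant cosimplicial spaces -/

lemma exists_hom_of_rel {X W : SSet.{u}} (R : ∀ k, X.obj k → W.obj k → Prop)
    (existsUnique : ∀ k x, ∃! w, R k x w)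
    (stable : ∀ k l (θ : k ⟶ l) x w, R k x w → R l (X.map θ x) (W.map θ w)) :
    ∃ f : X ⟶ W, ∀ k x, R k x (f.app k x) := by
  choose w hw hw' using existsUnique
  exact ⟨{ app := fun k ↦ ↾(w k)
           naturality := fun k l θ ↦ ConcreteCategory.hom_ext _ _ fun x ↦
             (hw' l _ _ (stable k l θ x _ (hw k x))).symm }, hw⟩

section

variable {D : Type} [SmallCategory D] {i : D ⥤ SimplexCategory}

namespace IsInitialSegment

variable (hi : IsInitialSegment i)

include hi

lemma exists_fac {d d' : D} (f : d ⟶ d') :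
    ∃ (e : D) (p : d ⟶ e) (m : e ⟶ d'), Epi (i.map p) ∧ Mono (i.map m) ∧ p ≫ m = f := by
  have := hi.full
  have := hi.faithful
  obtain ⟨e, he⟩ := hi.exists_obj_eq d' (Limits.image (i.map f))
    (SimplexCategory.len_le_of_mono (Limits.image.ι (i.map f)))
  refine ⟨e, i.preimage (Limits.factorThruImage (i.map f) ≫ eqToHom he.symm),
    i.preimage (eqToHom he ≫ Limits.image.ι (i.map f)), ?_, ?_, i.map_injective (by simp)⟩
  · rw [i.map_preimage]
    exact epi_comp _ _
  · rw [i.map_preimage]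
    exact mono_comp _ _

lemma eq_of_len_eq {d e : D} (h : (i.obj d).len = (i.obj e).len) : d = e :=
  hi.obj_injective (SimplexCategory.ext h)

lemma eq_of_epi {d e : D} (p : d ⟶ e) [Epi (i.map p)] (h : (i.obj d).len ≤ (i.obj e).len) :
    ∃ h : d = e, p = eqToHom h := by
  obtain rfl := hi.eq_of_len_eq (h.antisymm (SimplexCategory.len_le_of_epi (i.map p)))
  have := hi.faithful
  exact ⟨rfl, i.map_injective (by simpa using SimplexCategory.eq_id_of_epi (i.map p))⟩

lemma eq_of_mono {d e : D} (p : d ⟶ e) [Mono (i.map p)] (h : (i.obj e).len ≤ (i.obj d).len) :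
    ∃ h : d = e, p = eqToHom h := by
  obtain rfl := hi.eq_of_len_eq ((SimplexCategory.len_le_of_mono (i.map p)).antisymm h)
  have := hi.faithful
  exact ⟨rfl, i.map_injective (by simpa using SimplexCategory.eq_id_of_mono (i.map p))⟩

end IsInitialSegment

lemma matchingSpace_ext {Z : SimplexCategory ⥤ SSet.{u}} {n : SimplexCategory} {k}
    {w w' : (matchingSpace Z n).obj k} (h : ∀ p σ hσ hp, w.1 p σ hσ hp = w'.1 p σ hσ hp) :
    w = w' := by
  apply Subtype.ext
  funext p σ hσ hp
  exact h p σ hσ hp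

variable {P Q : D ⥤ SSet.{u}} {Z : SimplexCategory ⥤ SSet.{u}}

/-- An extension of `φ` along `j` to the objects of degree `< N`. -/
structure TruncatedExtension (j : Q ⟶ P) (φ : Q ⟶ i ⋙ Z) (N : ℕ) where
  app (d : D) (hd : (i.obj d).len < N) : P.obj d ⟶ (i ⋙ Z).obj d
  fac (d : D) (hd : (i.obj d).len < N) : j.app d ≫ app d hd = φ.app d
  naturality {d e : D} (f : d ⟶ e) (hd : (i.obj d).len < N) (he : (i.obj e).len < N) :
    app d hd ≫ (i ⋙ Z).map f = P.map f ≫ app e he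

namespace TruncatedExtension

variable {j : Q ⟶ P} {φ : Q ⟶ i ⋙ Z} {N : ℕ} (T : TruncatedExtension j φ N) {d e : D}
  {k : SimplexCategoryᵒᵖ}

lemma fac_apply (hd : (i.obj d).len < N) (q : (Q.obj d).obj k) :
    (T.app d hd).app k ((j.app d).app k q) = (φ.app d).app k q :=
  app_congr (T.fac d hd) q

lemma naturality_apply (f : d ⟶ e) (hd : (i.obj d).len < N) (he : (i.obj e).len < N)
    (x : (P.obj d).obj k) :
    ((i ⋙ Z).map f).app k ((T.app d hd).app k x) = (T.app e he).app k ((P.map f).app k x) :=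
  app_congr (T.naturality f hd he) x

lemma map_app_eq_of_pseudoInverse {f : e ⟶ d} {s : d ⟶ e} (hs : f ≫ s ≫ f = f)
    (he : (i.obj e).len < N) (y : (P.obj e).obj k) :
    ((i ⋙ Z).map f).app k ((T.app e he).app k y) =
      ((i ⋙ Z).map f).app k ((T.app e he).app k ((P.map s).app k ((P.map f).app k y))) := by
  rw [← map_comp_app_apply, ← T.naturality_apply (f ≫ s) he he, ← map_comp_app_apply,
    Category.assoc, hs]

lemma map_app_eq_of_map_eq (hi : IsInitialSegment i) (t : P ⟶ i ⋙ SSet.stdSimplex.{u})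
    {e' : D} {f : e ⟶ d} {f' : e' ⟶ d} (he : (i.obj e).len < N) (he' : (i.obj e').len < N)
    {y : (P.obj e).obj k} {y' : (P.obj e').obj k} (h : (P.map f).app k y = (P.map f').app k y') :
    ((i ⋙ Z).map f).app k ((T.app e he).app k y) =
      ((i ⋙ Z).map f').app k ((T.app e' he').app k y') := by
  obtain ⟨ρ, hρ, hmin⟩ := exists_minimal_endomorphism hi t ((P.map f).app k y)
  suffices key : ∀ (c : D) (g : c ⟶ d) (hc : (i.obj c).len < N) (w : (P.obj c).obj k),
      (P.map g).app k w = (P.map f).app k y → ((i ⋙ Z).map g).app k ((T.app c hc).app k w) =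
        ((i ⋙ Z).map (f ≫ ρ)).app k ((T.app e he).app k y) from
    (key e f he y rfl).trans (key e' f' he' y' h.symm).symm
  intro c g hc w hw
  obtain ⟨s, hs, hρs⟩ := hmin c g w hw
  rw [T.map_app_eq_of_pseudoInverse hs, hw, ← hρ, ← map_comp_app_apply, ← map_comp_app_apply,
    ← T.naturality_apply _ he hc, ← map_comp_app_apply, Category.assoc, Category.assoc, hρs]

lemma map_app_eq_of_map_eq_app (hi : IsInitialSegment i) [Mono (j.app d)] {f : e ⟶ d}
    (he : (i.obj e).len < N) {y : (P.obj e).obj k} {q : (Q.obj d).obj k}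
    (h : (P.map f).app k y = (j.app d).app k q) :
    ((i ⋙ Z).map f).app k ((T.app e he).app k y) = (φ.app d).app k q := by
  obtain ⟨s, hs, -⟩ := hi.exists_pseudoInverse f 0
  have hq : (Q.map (s ≫ f)).app k q = q := by
    apply (CategoryTheory.mono_iff_injective ((j.app d).app k)).1 inferInstance
    rw [← map_app_app_apply, ← h, ← map_comp_app_apply, hs]
  rw [T.map_app_eq_of_pseudoInverse hs, h, map_app_app_apply, T.fac_apply, map_app_app_apply,
    ← map_comp_app_apply, hq]

/-- The simplex `z` is the value at `x` which is imposed by `φ` and the truncated extension `T`. -/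
def Prescribes (hd : (i.obj d).len ≤ N) (k) (x : (P.obj d).obj k) (z : ((i ⋙ Z).obj d).obj k) :
    Prop :=
  (∀ q, (j.app d).app k q = x → z = (φ.app d).app k q) ∧
    ∀ (e : D) (f : e ⟶ d) (he : (i.obj e).len < (i.obj d).len) (y : (P.obj e).obj k),
      (P.map f).app k y = x → z = ((i ⋙ Z).map f).app k ((T.app e (he.trans_le hd)).app k y)

lemma existsUnique_prescribes (hi : IsInitialSegment i) (t : P ⟶ i ⋙ SSet.stdSimplex.{u})
    [∀ d, Mono (j.app d)] (hd : (i.obj d).len ≤ N) {x : (P.obj d).obj k}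
    (hx : x ∈ (relativeLatching i j d).obj k) : ∃! z, T.Prescribes hd k x z := by
  obtain ⟨q, rfl⟩ | ⟨e, f, y, he, rfl⟩ := hx
  · refine ⟨(φ.app d).app k q, ⟨fun q' hq' ↦ ?_, fun e f he y hy ↦ ?_⟩, fun z hz ↦ hz.1 q rfl⟩
    · rw [(CategoryTheory.mono_iff_injective ((j.app d).app k)).1 inferInstance hq']
    · exact (T.map_app_eq_of_map_eq_app hi (he.trans_le hd) hy).symm
  · refine ⟨((i ⋙ Z).map f).app k ((T.app e (he.trans_le hd)).app k y),
      ⟨fun q hq ↦ ?_, fun e' f' he' y' hy' ↦ ?_⟩, fun z hz ↦ hz.2 e f he y rfl⟩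
    · exact T.map_app_eq_of_map_eq_app hi (he.trans_le hd) hq.symm
    · exact T.map_app_eq_of_map_eq hi t (he.trans_le hd) (he'.trans_le hd) hy'.symm

lemma exists_latching (hi : IsInitialSegment i) (t : P ⟶ i ⋙ SSet.stdSimplex.{u})
    [∀ d, Mono (j.app d)] (hd : (i.obj d).len ≤ N) :
    ∃ a : (relativeLatching i j d : SSet.{u}) ⟶ (i ⋙ Z).obj d,
      ∀ k x, T.Prescribes hd k x.1 (a.app k x) := by
  refine exists_hom_of_rel _ (fun k x ↦ T.existsUnique_prescribes hi t hd x.2)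
    fun k l θ x z hz ↦ ?_
  obtain ⟨w, hw, -⟩ := T.existsUnique_prescribes hi t hd ((relativeLatching i j d).map θ x.2)
  suffices h : ((i ⋙ Z).obj d).map θ z = w by rwa [h]
  obtain ⟨q, hq⟩ | ⟨e, f, y, he, hy⟩ := x.2
  · rw [hz.1 q hq, hw.1 ((Q.obj d).map θ q) (by rw [NatTrans.naturality_apply, hq]),
      NatTrans.naturality_apply]
  · rw [hz.2 e f he y hy, hw.2 e f he ((P.obj e).map θ y) (by rw [NatTrans.naturality_apply, hy]),
      NatTrans.naturality_apply, NatTrans.naturality_apply]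

lemma exists_matching (hi : IsInitialSegment i) (hd : (i.obj d).len ≤ N) :
    ∃ b : P.obj d ⟶ matchingSpace Z (i.obj d), ∀ (e : D) (f : d ⟶ e) (hf : Epi (i.map f))
      (he : (i.obj e).len < (i.obj d).len) (k) (x : (P.obj d).obj k),
      (b.app k x).1 (i.obj e) (i.map f) hf he =
        (T.app e (he.trans_le hd)).app k ((P.map f).app k x) := by
  have := hi.full
  have := hi.faithful
  have value (p : SimplexCategory) (σ : i.obj d ⟶ p) (hp : p.len < (i.obj d).len) :
      ∃ F : P.obj d ⟶ Z.obj p, ∀ (e : D) (f : d ⟶ e) (g : p ⟶ i.obj e) (he : (i.obj e).len < N),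
        σ ≫ g = i.map f → F ≫ Z.map g = P.map f ≫ T.app e he := by
    obtain ⟨c, rfl⟩ := hi.exists_obj_eq d p hp.le
    refine ⟨P.map (i.preimage σ) ≫ T.app c (hp.trans_le hd), fun e f g he h ↦ ?_⟩
    obtain rfl : i.preimage σ ≫ i.preimage g = f := i.map_injective (by simpa)
    have hg := T.naturality (i.preimage g) (hp.trans_le hd) he
    rw [P.map_comp, Category.assoc, Category.assoc, ← hg]
    simp
  choose F hF using value
  have comp (p q : SimplexCategory) (σ : i.obj d ⟶ p) (τ : p ⟶ q) (hp : p.len < (i.obj d).len)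
      (hq : q.len < (i.obj d).len) : F p σ hp ≫ Z.map τ = F q (σ ≫ τ) hq := by
    obtain ⟨c, rfl⟩ := hi.exists_obj_eq d q hq.le
    rw [hF p σ hp c (i.preimage (σ ≫ τ)) τ (hq.trans_le hd) (i.map_preimage _).symm,
      ← hF _ (σ ≫ τ) hq c (i.preimage (σ ≫ τ)) (𝟙 _) (hq.trans_le hd) (by simp)]
    simp
  refine ⟨{ app k := ↾fun x ↦ ⟨fun p σ _ hp ↦ (F p σ hp).app k x,
              fun p q σ τ _ hp _ hq ↦ app_congr (comp p q σ τ hp hq) x⟩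
            naturality k l θ := ConcreteCategory.hom_ext _ _ fun x ↦
              matchingSpace_ext fun p σ _ hp ↦ NatTrans.naturality_apply (F p σ hp) θ x }, ?_⟩
  intro e f _ he k x
  have h := app_congr (hF _ (i.map f) he e f (𝟙 _) (he.trans_le hd) (Category.comp_id _)) x
  rw [Z.map_id, Category.comp_id] at h
  exact h

lemma exists_extension_obj (hi : IsInitialSegment i) (t : P ⟶ i ⋙ SSet.stdSimplex.{u})
    [∀ d, Mono (j.app d)] (hj : ∀ d, SSet.anodyneExtensions (j.app d))
    (hZ : IsFibrantCosimplicial Z) (hd : (i.obj d).len ≤ N) :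
    ∃ F : P.obj d ⟶ (i ⋙ Z).obj d, j.app d ≫ F = φ.app d ∧
      (∀ (e : D) (m : e ⟶ d) (he : (i.obj e).len < (i.obj d).len),
        T.app e (he.trans_le hd) ≫ (i ⋙ Z).map m = P.map m ≫ F) ∧
      (∀ (e : D) (p : d ⟶ e) (_ : Epi (i.map p)) (he : (i.obj e).len < (i.obj d).len),
        F ≫ (i ⋙ Z).map p = P.map p ≫ T.app e (he.trans_le hd)) := by
  obtain ⟨a, ha⟩ := T.exists_latching hi t hd
  obtain ⟨b, hb⟩ := T.exists_matching hi hd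
  have sq : CommSq a (relativeLatching i j d).ι (matchingMap Z (i.obj d)) b := by
    refine ⟨hom_ext_apply fun k x ↦ matchingSpace_ext fun p σ hσ hp ↦ ?_⟩
    have := hi.full
    obtain ⟨c, rfl⟩ := hi.exists_obj_eq d p hp.le
    obtain ⟨p, rfl⟩ := i.map_surjective σ
    refine Eq.trans ?_ (hb c p hσ hp k x.1).symm
    change ((i ⋙ Z).map p).app k (a.app k x) = _
    obtain ⟨q, hq⟩ | ⟨e, f, y, he, hy⟩ := x.2
    · rw [(ha k x).1 q hq, ← hq, map_app_app_apply, map_app_app_apply, T.fac_apply]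
    · rw [(ha k x).2 e f he y hy, ← hy, ← map_comp_app_apply, ← map_comp_app_apply,
        T.naturality_apply _ (he.trans_le hd)]
  have := hZ (i.obj d)
  have := anodyneExtensions_relativeLatching hi t j hj d (matchingMap Z (i.obj d))
    (mem_fibrations _)
  have hlift {k} {x} (hx : x ∈ (relativeLatching i j d).obj k) :
      T.Prescribes hd k x (sq.lift.app k x) := by
    have h := ha k ⟨x, hx⟩
    rwa [← app_congr sq.fac_left ⟨x, hx⟩] at h
  refine ⟨sq.lift, hom_ext_apply fun k q ↦ ?_, fun e m he ↦ hom_ext_apply fun k y ↦ ?_,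
    fun e p hp he ↦ hom_ext_apply fun k x ↦ ?_⟩
  · exact (hlift (Or.inl ⟨q, rfl⟩)).1 q rfl
  · exact ((hlift (Or.inr ⟨e, m, y, he, rfl⟩)).2 e m he y rfl).symm
  · exact (congrArg (fun w ↦ w.1 _ (i.map p) hp he) (app_congr sq.fac_right x)).trans
      (hb e p hp he k x)

lemma exists_succ (hi : IsInitialSegment i) (t : P ⟶ i ⋙ SSet.stdSimplex.{u})
    [∀ d, Mono (j.app d)] (hj : ∀ d, SSet.anodyneExtensions (j.app d))
    (hZ : IsFibrantCosimplicial Z) :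
    ∃ T' : TruncatedExtension j φ (N + 1), ∀ (d : D) (h : (i.obj d).len < N),
      T'.app d (h.trans N.lt_succ_self) = T.app d h := by
  choose F hF₁ hF₂ hF₃ using fun (d : D) (h : (i.obj d).len ≤ N) ↦
    T.exists_extension_obj hi t hj hZ h
  let G (d : D) (h : (i.obj d).len < N + 1) : P.obj d ⟶ (i ⋙ Z).obj d :=
    if h' : (i.obj d).len < N then T.app d h' else F d (Nat.le_of_lt_succ h)
  have hG (d : D) (h' : (i.obj d).len < N) (h) : G d h = T.app d h' := dif_pos h'
  have hG' (d : D) (h' : ¬ (i.obj d).len < N) (h) : G d h = F d (Nat.le_of_lt_succ h) :=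
    dif_neg h'
  have hepi {d e : D} (p : d ⟶ e) (_ : Epi (i.map p)) (h : (i.obj d).len < N + 1)
      (h' : (i.obj e).len < N + 1) : G d h ≫ (i ⋙ Z).map p = P.map p ≫ G e h' := by
    by_cases he : (i.obj e).len < (i.obj d).len
    · rw [hG e (by omega) h']
      by_cases h₁ : (i.obj d).len < N
      · rw [hG d h₁ h, T.naturality]
      · rw [hG' d h₁ h, hF₃ d _ e p inferInstance he]
    · obtain ⟨rfl, rfl⟩ := hi.eq_of_epi p (by omega)
      simp
  have hmono {d e : D} (p : d ⟶ e) (_ : Mono (i.map p)) (h : (i.obj d).len < N + 1)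
      (h' : (i.obj e).len < N + 1) : G d h ≫ (i ⋙ Z).map p = P.map p ≫ G e h' := by
    by_cases he : (i.obj d).len < (i.obj e).len
    · rw [hG d (by omega) h]
      by_cases h₁ : (i.obj e).len < N
      · rw [hG e h₁ h', T.naturality]
      · rw [hG' e h₁ h', hF₂ e _ d p he]
    · obtain ⟨rfl, rfl⟩ := hi.eq_of_mono p (by omega)
      simp
  refine ⟨⟨G, fun d h ↦ ?_, fun {d d'} g h h' ↦ ?_⟩, fun d h ↦ hG d h (h.trans N.lt_succ_self)⟩
  · by_cases h₁ : (i.obj d).len < N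
    · rw [hG d h₁ h, T.fac]
    · rw [hG' d h₁ h, hF₁]
  · obtain ⟨e, p, m, hp, hm, rfl⟩ := hi.exists_fac g
    have he := SimplexCategory.len_le_of_mono (i.map m)
    rw [Functor.map_comp, P.map_comp, ← Category.assoc, hepi p hp h (he.trans_lt h'),
      Category.assoc, hmono m hm (he.trans_lt h') h', Category.assoc]

end TruncatedExtension

theorem exists_extension (hi : IsInitialSegment i) (t : P ⟶ i ⋙ SSet.stdSimplex.{u}) {j : Q ⟶ P}
    [∀ d, Mono (j.app d)] (hj : ∀ d, SSet.anodyneExtensions (j.app d))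
    (hZ : IsFibrantCosimplicial Z) (φ : Q ⟶ i ⋙ Z) : ∃ Φ : P ⟶ i ⋙ Z, j ≫ Φ = φ := by
  choose next hnext using fun (N : ℕ) (T : TruncatedExtension j φ N) ↦ T.exists_succ hi t hj hZ
  let T (N : ℕ) : TruncatedExtension j φ N :=
    Nat.rec ⟨fun _ h ↦ (Nat.not_lt_zero _ h).elim, fun _ h ↦ (Nat.not_lt_zero _ h).elim,
      fun _ h ↦ (Nat.not_lt_zero _ h).elim⟩ next N
  have hT (d : D) (N : ℕ) (h : (i.obj d).len < N) :
      (T N).app d h = (T ((i.obj d).len + 1)).app d (Nat.lt_succ_self _) := by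
    obtain ⟨k, rfl⟩ := Nat.exists_eq_add_of_le (Nat.succ_le_of_lt h)
    induction k with
    | zero => rfl
    | succ k hk =>
      rw [← hk (by omega)]
      exact hnext _ (T (((i.obj d).len + 1) + k)) d (by omega)
  refine ⟨{
    app d := (T ((i.obj d).len + 1)).app d (Nat.lt_succ_self _)
    naturality d d' f := ?_ }, NatTrans.ext (funext fun d ↦
      (T ((i.obj d).len + 1)).fac d (Nat.lt_succ_self _))⟩
  have h := (T ((i.obj d).len + (i.obj d').len + 1)).naturality f (by omega) (by omega)
  rw [hT d _ (by omega), hT d' _ (by omega)] at h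
  exact h.symm

end

/-! ### Homotopies and weak equivalences -/

section

variable {X Y : SSet.{u}} {f g : X ⟶ Y}

/-- Constructor for homotopies which omits the vacuous condition on the empty subcomplex. -/
def homotopyMk (H : X ⊗ Δ[1] ⟶ Y) (h₀ : SSet.ι₀ ≫ H = f) (h₁ : SSet.ι₁ ≫ H = g) :
    SSet.Homotopy f g where
  h := H
  h₀ := h₀
  h₁ := h₁
  rel := hom_ext_apply fun _ x ↦ x.1.2.elim

lemma mapπ₀_eq_of_homotopy (H : SSet.Homotopy f g) : SSet.mapπ₀ f = SSet.mapπ₀ g := by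
  funext v
  obtain ⟨v, rfl⟩ := SSet.π₀.mk_surjective v
  let t : Δ[1] _⦋1⦌ := SSet.stdSimplex.objEquiv.symm (𝟙 _)
  have hface (a b : Fin 2) (hv : X.δ a (X.σ 0 v) = v)
      (ht : Δ[1].δ a t = SSet.stdSimplex.obj₀Equiv.symm b) :
      Y.δ a (H.h.app (op ⦋1⦌) (X.σ 0 v, t)) =
        H.h.app (op ⦋0⦌) (v, SSet.stdSimplex.obj₀Equiv.symm b) :=
    (SSet.δ_naturality_apply H.h a _).symm.trans
      (congrArg (H.h.app (op ⦋0⦌)) (Prod.ext hv ht))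
  have e := SSet.Edge.mk' (H.h.app (op ⦋1⦌) (X.σ 0 v, t))
  rw [hface 1 0 (X.δ_comp_σ_succ_apply 0 v) (SSet.stdSimplex.obj₀Equiv.injective rfl),
    hface 0 1 (X.δ_comp_σ_self_apply 0 v) (SSet.stdSimplex.obj₀Equiv.injective rfl)] at e
  rw [SSet.mapπ₀_mk, SSet.mapπ₀_mk, ← app_congr H.h₀ v, ← app_congr H.h₁ v]
  exact SSet.π₀.sound e

/-- The homotopy from `f^*` to `g^*` induced by a homotopy from `f` to `g`. -/
def homotopyPre (H : SSet.Homotopy f g) (K : SSet.{u}) :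
    SSet.Homotopy ((MonoidalClosed.pre f).app K) ((MonoidalClosed.pre g).app K) := by
  refine homotopyMk (MonoidalClosed.curry (lift (lift (fst _ _) (snd _ _ ≫ snd _ _) ≫ H.h)
    (snd _ _ ≫ fst _ _) ≫ (ihom.ev Y).app K)) ?_ ?_
  · rw [← MonoidalClosed.curry_natural_left]
    conv_rhs => rw [← H.h₀]
    rfl
  · rw [← MonoidalClosed.curry_natural_left]
    conv_rhs => rw [← H.h₁]
    rfl

end

lemma IsWeakEquivalence.comp {X Y Z : SSet.{u}} {f : X ⟶ Y} {g : Y ⟶ Z}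
    (hf : IsWeakEquivalence f) (hg : IsWeakEquivalence g) : IsWeakEquivalence (f ≫ g) := by
  intro K hK
  convert! (hf K hK).comp (hg K hK) using 1
  funext v
  rw [MonoidalClosed.pre_map]
  exact SSet.mapπ₀_comp_apply _ _ _

lemma isWeakEquivalence_of_homotopy {X Y : SSet.{u}} {f : X ⟶ Y} {g : Y ⟶ X}
    (H : SSet.Homotopy (𝟙 X) (f ≫ g)) (H' : SSet.Homotopy (g ≫ f) (𝟙 Y)) :
    IsWeakEquivalence f := by
  intro K _
  have hinv {X Y : SSet.{u}} {f : X ⟶ Y} {g : Y ⟶ X}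
      (h : SSet.mapπ₀ ((MonoidalClosed.pre (f ≫ g)).app K) =
        SSet.mapπ₀ ((MonoidalClosed.pre (𝟙 X)).app K)) :
      Function.LeftInverse (SSet.mapπ₀ ((MonoidalClosed.pre f).app K))
        (SSet.mapπ₀ ((MonoidalClosed.pre g).app K)) := by
    intro v
    rw [← SSet.mapπ₀_comp_apply, ← NatTrans.comp_app, ← MonoidalClosed.pre_map, h,
      MonoidalClosed.pre_id]
    exact SSet.mapπ₀_id_apply v
  exact ⟨(hinv (mapπ₀_eq_of_homotopy (homotopyPre H' K))).injective,
    (hinv (mapπ₀_eq_of_homotopy (homotopyPre H K)).symm).surjective⟩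

lemma isWeakEquivalence_of_isIso {X Y : SSet.{u}} (f : X ⟶ Y) [IsIso f] :
    IsWeakEquivalence f :=
  isWeakEquivalence_of_homotopy (g := inv f)
    (homotopyMk (fst _ _) rfl (IsIso.hom_inv_id f).symm)
    (homotopyMk (fst _ _) (IsIso.inv_hom_id f).symm rfl)

lemma isWeakEquivalence_of_rlp {X Y : SSet.{u}} {p : X ⟶ Y}
    (hp : (MorphismProperty.monomorphisms SSet.{u}).rlp p) : IsWeakEquivalence p := by
  have := hp (Limits.initial.to Y) (MorphismProperty.monomorphisms.infer_property _)
  have sq : CommSq (Limits.initial.to X) (Limits.initial.to Y) p (𝟙 Y) := ⟨by simp⟩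
  let po := SSet.Subcomplex.unionProd.pushoutObjObj (⊥ : X.Subcomplex) (SSet.boundary.{u} 1)
  have : HasLiftingProperty po.ι p :=
    hp _ (inferInstanceAs (Mono (SSet.Subcomplex.unionProd _ _).ι))
  obtain ⟨H, h₀, h₁, -, -⟩ := exists_homotopy po (p := p) (f₀ := 𝟙 X) (f₁ := p ≫ sq.lift)
    (hom_ext_apply fun _ x ↦ x.2.elim) (by rw [Category.assoc, sq.fac_right]; rfl)
  exact isWeakEquivalence_of_homotopy (g := sq.lift) (homotopyMk H h₀ h₁)
    (homotopyMk (fst _ _) sq.fac_right.symm rfl)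

/-! ### The adjunction between tensors and mapping spaces -/

section

variable {D : Type} [SmallCategory D] {A A' B : D ⥤ SSet.{u}} {K L : SSet.{u}}

lemma tensor_hom_ext {Φ Ψ : A ⋙ tensorRight L ⟶ B}
    (h : ∀ d m (a : (A.obj d).obj m) (l : L.obj m),
      (Φ.app d).app m (a, l) = (Ψ.app d).app m (a, l)) :
    Φ = Ψ :=
  NatTrans.ext (funext fun d ↦ hom_ext_apply fun m x ↦ h d m x.1 x.2)

lemma mapSpace_map_app_apply {k m : SimplexCategoryᵒᵖ} (φ : (mapSpace A B).obj k) (θ : k ⟶ m)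
    {d : D} (a : (A.obj d).obj m) :
    (((mapSpace A B).map θ φ : _ ⟶ B).app d).app m (a, SSet.stdSimplex.objEquiv.symm (𝟙 _)) =
      ((φ : _ ⟶ B).app d).app m (a, SSet.stdSimplex.objEquiv.symm θ.unop) :=
  congrArg (fun t ↦ ((φ : _ ⟶ B).app d).app m (a, SSet.stdSimplex.objEquiv.symm t))
    (Category.id_comp θ.unop)

/-- The evaluation `A × hom(A, B) ⟶ B`, which pairs a simplex `a` of dimension `m` with a map
`φ : A × Δ[m] ⟶ B` to the value of `φ` at `a` and the fundamental simplex. -/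
def mapSpaceEval (A B : D ⥤ SSet.{u}) : A ⋙ tensorRight (mapSpace A B) ⟶ B where
  app d :=
    { app m := ↾fun x ↦ ((x.2 : _ ⟶ B).app d).app m (x.1, SSet.stdSimplex.objEquiv.symm (𝟙 _))
      naturality m m' θ := by
        refine ConcreteCategory.hom_ext _ _ fun x ↦ ?_
        have h := NatTrans.naturality_apply ((x.2 : _ ⟶ B).app d) θ
          ((x.1, SSet.stdSimplex.objEquiv.symm (𝟙 m.unop)) : (A.obj d ⊗ Δ[m.unop.len]).obj m)
        refine (mapSpace_map_app_apply x.2 θ _).trans (Eq.trans ?_ h)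
        exact congrArg (fun t ↦ ((x.2 : _ ⟶ B).app d).app m'
          ((A.obj d).map θ x.1, SSet.stdSimplex.objEquiv.symm t)) (Category.comp_id θ.unop).symm }
  naturality d d' f := NatTrans.ext (funext fun m ↦ ConcreteCategory.hom_ext _ _ fun x ↦
    app_congr ((x.2 : _ ⟶ B).naturality f) (x.1, _))

/-- The map `L ⟶ hom(A, B)` corresponding to a map of diagrams `A × L ⟶ B`. -/
def mapSpaceCurry (Φ : A ⋙ tensorRight L ⟶ B) : L ⟶ mapSpace A B where
  app k := ↾fun l ↦ Functor.whiskerLeft A ((tensoringRight SSet.{u}).map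
    (SSet.yonedaEquiv.symm l)) ≫ Φ
  naturality k l θ := by
    refine ConcreteCategory.hom_ext _ _ fun x ↦ tensor_hom_ext fun d m a y ↦ ?_
    exact congrArg (fun t ↦ (Φ.app d).app m (a, t))
      (ConcreteCategory.congr_hom (L.map_comp θ (SSet.stdSimplex.objEquiv y).op) x).symm

/-- The map of diagrams `A × L ⟶ B` corresponding to a map `L ⟶ hom(A, B)`. -/
def mapSpaceUncurry (f : L ⟶ mapSpace A B) : A ⋙ tensorRight L ⟶ B :=
  Functor.whiskerLeft A ((tensoringRight SSet.{u}).map f) ≫ mapSpaceEval A B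

lemma mapSpaceCurry_uncurry (f : L ⟶ mapSpace A B) : mapSpaceCurry (mapSpaceUncurry f) = f := by
  refine hom_ext_apply fun k l ↦ tensor_hom_ext fun d m a y ↦ ?_
  obtain ⟨θ, rfl⟩ := SSet.stdSimplex.objEquiv.symm.surjective y
  refine Eq.trans ?_ (mapSpace_map_app_apply (f.app k l) θ.op a)
  rw [← NatTrans.naturality_apply]
  rfl

lemma mapSpaceUncurry_curry (Φ : A ⋙ tensorRight L ⟶ B) :
    mapSpaceUncurry (mapSpaceCurry Φ) = Φ :=
  tensor_hom_ext fun d m a l ↦ congrArg (fun t ↦ (Φ.app d).app m (a, t))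
    (ConcreteCategory.congr_hom (L.map_id m) l)

lemma comp_mapSpaceCurry (f : K ⟶ L) (Φ : A ⋙ tensorRight L ⟶ B) :
    f ≫ mapSpaceCurry Φ =
      mapSpaceCurry (Functor.whiskerLeft A ((tensoringRight SSet.{u}).map f) ≫ Φ) :=
  hom_ext_apply fun _ l ↦ tensor_hom_ext fun d m a t ↦ congrArg (fun t ↦ (Φ.app d).app m (a, t))
    (NatTrans.naturality_apply f (SSet.stdSimplex.objEquiv t).op l).symm

lemma mapSpaceCurry_comp_pre (Φ : A ⋙ tensorRight L ⟶ B) (a : A' ⟶ A) :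
    mapSpaceCurry Φ ≫ mapSpacePre a B =
      mapSpaceCurry (Functor.whiskerRight a (tensorRight L) ≫ Φ) :=
  rfl

/-- The homotopy from `a^*` to `a'^*` on mapping spaces induced by a homotopy from `a` to `a'`. -/
def mapSpacePreHomotopy {a a' : A' ⟶ A} (H : A' ⋙ tensorRight Δ[1] ⟶ A)
    (h₀ : ∀ d, SSet.ι₀ ≫ H.app d = a.app d) (h₁ : ∀ d, SSet.ι₁ ≫ H.app d = a'.app d)
    (B : D ⥤ SSet.{u}) : SSet.Homotopy (mapSpacePre a B) (mapSpacePre a' B) := by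
  let Φ : A' ⋙ tensorRight (mapSpace A B ⊗ Δ[1]) ⟶ B :=
    { app d := lift (lift (fst _ _) (snd _ _ ≫ snd _ _) ≫ H.app d) (snd _ _ ≫ fst _ _) ≫
        (mapSpaceEval A B).app d
      naturality d d' f := hom_ext_apply fun m x ↦ by
        have h := app_congr (H.naturality f) (x.1, x.2.2)
        have h' := app_congr ((mapSpaceEval A B).naturality f) ((H.app d).app m (x.1, x.2.2), x.2.1)
        exact (congrArg (fun y ↦ ((mapSpaceEval A B).app d').app m (y, x.2.1)) h).trans h' }
  have hpre (a : A' ⟶ A) : mapSpacePre a B = mapSpaceCurry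
      (Functor.whiskerRight a (tensorRight (mapSpace A B)) ≫ mapSpaceEval A B) := by
    rw [← mapSpaceCurry_comp_pre]
    exact (congrArg (· ≫ mapSpacePre a B) (mapSpaceCurry_uncurry (𝟙 (mapSpace A B)))).symm
  have hend {b : A' ⟶ A} (j : mapSpace A B ⟶ mapSpace A B ⊗ Δ[1])
      (h : Functor.whiskerLeft A' ((tensoringRight SSet.{u}).map j) ≫ Φ =
        Functor.whiskerRight b (tensorRight (mapSpace A B)) ≫ mapSpaceEval A B) :
      j ≫ mapSpaceCurry Φ = mapSpacePre b B := by
    rw [comp_mapSpaceCurry, hpre, h]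
  refine homotopyMk (mapSpaceCurry Φ) (hend _ ?_) (hend _ ?_)
  · exact tensor_hom_ext fun d m x φ ↦
      congrArg (fun y ↦ ((mapSpaceEval A B).app d).app m (y, φ)) (app_congr (h₀ d) x)
  · exact tensor_hom_ext fun d m x φ ↦
      congrArg (fun y ↦ ((mapSpaceEval A B).app d).app m (y, φ)) (app_congr (h₁ d) x)

end

section

variable {D : Type} [SmallCategory D] {i : D ⥤ SimplexCategory} {A B : D ⥤ SSet.{u}}
  {Z : SimplexCategory ⥤ SSet.{u}} {K L : SSet.{u}}

lemma anodyneExtensions_le_monomorphisms :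
    SSet.anodyneExtensions.{u} ≤ MorphismProperty.monomorphisms SSet := by
  rw [SSet.anodyneExtensions_eq_retracts_transfiniteCompositions]
  simp only [MorphismProperty.retracts_le_iff, MorphismProperty.transfiniteCompositions_le_iff,
    MorphismProperty.pushouts_le_iff]
  exact MorphismProperty.coproducts_le_iff.2 SSet.modelCategoryQuillen.J_le_monomorphisms

lemma exists_tensor_extension (hi : IsInitialSegment i) (t : B ⟶ i ⋙ SSet.stdSimplex.{u})
    {j : A ⟶ B} (hj : ∀ d, SSet.anodyneExtensions (j.app d)) (k : K ⟶ L) [Mono k]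
    (hZ : IsFibrantCosimplicial Z) {φ : B ⋙ tensorRight K ⟶ i ⋙ Z}
    {ψ : A ⋙ tensorRight L ⟶ i ⋙ Z}
    (h : Functor.whiskerRight j (tensorRight K) ≫ φ =
      Functor.whiskerLeft A ((tensoringRight SSet.{u}).map k) ≫ ψ) :
    ∃ Φ : B ⋙ tensorRight L ⟶ i ⋙ Z,
      Functor.whiskerLeft B ((tensoringRight SSet.{u}).map k) ≫ Φ = φ ∧
        Functor.whiskerRight j (tensorRight L) ≫ Φ = ψ := by
  let po := IsPushout.of_hasPushout (Functor.whiskerRight j (tensorRight K))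
    (Functor.whiskerLeft A ((tensoringRight SSet.{u}).map k))
  let e := po.desc (Functor.whiskerLeft B ((tensoringRight SSet.{u}).map k))
    (Functor.whiskerRight j (tensorRight L)) rfl
  have he (d : D) : SSet.anodyneExtensions (e.app d) := by
    let sq : (curriedTensor SSet.{u}).PushoutObjObj (j.app d) k :=
      { pt := _
        inl := _
        inr := _
        isPushout := po.map ((evaluation _ _).obj d)
        ι := e.app d
        inl_ι := NatTrans.congr_app (po.inl_desc _ _ rfl) d
        inr_ι := NatTrans.congr_app (po.inr_desc _ _ rfl) d }
    exact SSet.anodyneExtensions_pushoutObjObjι' sq (hj d)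
  have (d : D) : Mono (e.app d) := anodyneExtensions_le_monomorphisms _ (he d)
  obtain ⟨Φ, hΦ⟩ := exists_extension hi
    ({ app d := fst _ _ ≫ t.app d
       naturality d d' f := congrArg (fst _ _ ≫ ·) (t.naturality f) } :
      B ⋙ tensorRight L ⟶ i ⋙ SSet.stdSimplex.{u}) he hZ (po.desc φ ψ h)
  refine ⟨Φ, ?_, ?_⟩
  · rw [← po.inl_desc (Functor.whiskerLeft B ((tensoringRight SSet.{u}).map k))
    (Functor.whiskerRight j (tensorRight L)) rfl, Category.assoc, hΦ, po.inl_desc]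
  · rw [← po.inr_desc (Functor.whiskerLeft B ((tensoringRight SSet.{u}).map k))
    (Functor.whiskerRight j (tensorRight L)) rfl, Category.assoc, hΦ, po.inr_desc]

lemma isWeakEquivalence_mapSpacePre_of_anodyneExtensions (hi : IsInitialSegment i)
    (t : B ⟶ i ⋙ SSet.stdSimplex.{u}) {j : A ⟶ B} (hj : ∀ d, SSet.anodyneExtensions (j.app d))
    (hZ : IsFibrantCosimplicial Z) : IsWeakEquivalence (mapSpacePre j (i ⋙ Z)) := by
  refine isWeakEquivalence_of_rlp fun K L k (hk : Mono k) ↦ ⟨fun {f g} sq ↦ ?_⟩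
  obtain ⟨Φ, hφ, hψ⟩ := exists_tensor_extension hi t hj k hZ (φ := mapSpaceUncurry f)
    (ψ := mapSpaceUncurry g) (by
      apply Function.LeftInverse.injective mapSpaceUncurry_curry
      rw [← comp_mapSpaceCurry, ← mapSpaceCurry_comp_pre, mapSpaceCurry_uncurry,
        mapSpaceCurry_uncurry, sq.w])
  exact ⟨⟨⟨mapSpaceCurry Φ, by rw [comp_mapSpaceCurry, hφ, mapSpaceCurry_uncurry],
    by rw [mapSpaceCurry_comp_pre, hψ, mapSpaceCurry_uncurry]⟩⟩⟩

end

/-! ### Nerves of categories with an initial object -/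

section

variable {C : Type} [SmallCategory C] {I : C}

/-- The chain `j ↦ F (s j) (c j)` obtained from a chain `c` of `C`, a simplex `s` of `Δ[1]` and
a natural transformation `F`, viewed as a functor `[1] ⥤ (C ⥤ C)`. -/
def chainEval (F : ComposableArrows (C ⥤ C) 1) {n : SimplexCategory}
    (c : ComposableArrows C n.len) (s : n ⟶ ⦋1⦌) : ComposableArrows C n.len :=
  Functor.prod' (s.toOrderHom.monotone.functor ⋙ F) c ⋙ Functor.uncurry.obj (𝟭 _)

/-- The contraction of the nerve of a category onto an initial object. -/
def nerveContraction (hI : Limits.IsInitial I) :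
    Contraction (X := SSet.uliftFunctor.{u, 0}.obj (nerve C)) ⟨ComposableArrows.mk₀ I⟩ := by
  let F : ComposableArrows (C ⥤ C) 1 := ComposableArrows.mk₁
    (X₀ := (Functor.const C).obj I) (X₁ := 𝟭 C) { app X := hI.to X }
  have hF (a : Fin 2) : (F.obj a).obj I = I := by fin_cases a <;> rfl
  exact
    { homotopy :=
        { app k := ↾fun x ↦ ⟨chainEval F x.1.down (SSet.stdSimplex.objEquiv x.2)⟩
          naturality k l θ := rfl }
      ι₀_homotopy := hom_ext_apply fun k x ↦ ULift.ext _ _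
        (CategoryTheory.Functor.ext (fun j ↦ rfl) fun j j' f ↦ hI.hom_ext _ _)
      ι₁_homotopy := hom_ext_apply fun k x ↦ ULift.ext _ _
        (CategoryTheory.Functor.hext (fun _ ↦ rfl) fun _ _ _ ↦ heq_of_eq (Category.id_comp _))
      const_homotopy := hom_ext_apply fun k x ↦ ULift.ext _ _
        (CategoryTheory.Functor.ext (fun j ↦ hF _) fun j j' f ↦
          (hI.ofIso (eqToIso (hF _).symm)).hom_ext _ _) }

/-- The contraction of `N(D/d)` onto the vertex `𝟙 d`. -/
def overNerveContraction {D : Type} [SmallCategory D] (d : D) :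
    Contraction (X := (overNerve.{u} D).obj d) ⟨ComposableArrows.mk₀ (op (Over.mk (𝟙 d)))⟩ :=
  nerveContraction (Limits.initialOpOfTerminal Over.mkIdTerminal)

/-- The contraction of a standard simplex onto its vertex `0`. -/
def stdSimplexContraction (q : SimplexCategory) :
    Contraction (X := (SSet.stdSimplex : SimplexCategory ⥤ SSet.{u}).obj q)
      (SSet.stdSimplex.obj₀Equiv.symm 0) where
  homotopy :=
    { app k := ↾fun x ↦ SSet.stdSimplex.objMk (SSet.stdSimplex.asOrderHom x.1 ⊓
        (OrderHom.mk ![⊥, ⊤] (by simp [Monotone, Fin.forall_fin_two])).comp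
          (SSet.stdSimplex.asOrderHom x.2))
      naturality k l θ := rfl }
  ι₀_homotopy := hom_ext_apply fun k x ↦ SSet.stdSimplex.ext _ _ fun j ↦ inf_bot_eq _
  ι₁_homotopy := hom_ext_apply fun k x ↦ SSet.stdSimplex.ext _ _ fun j ↦ inf_top_eq _
  const_homotopy := hom_ext_apply fun k x ↦ SSet.stdSimplex.ext _ _ fun j ↦ bot_inf_eq _

end

/-! ### Cofree simplicial sets -/

section

/-- The cofree simplicial set on the family of pointed sets `Option (X.obj j)`: a `k`-simplex is an
arbitrary family of elements of these, indexed by the operators `φ : j ⟶ k`. It contains `X`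
naturally and has a natural base point, onto which it contracts naturally. -/
def cofree : SSet.{u} ⥤ SSet.{u} where
  obj X :=
    { obj k := ∀ j : SimplexCategory, (j ⟶ k.unop) → Option (X.obj (op j))
      map θ := ↾fun x j φ ↦ x j (φ ≫ θ.unop) }
  map f := { app k := ↾fun x j φ ↦ (x j φ).map (f.app (op j)) }

/-- The canonical inclusion of a simplicial set in its cofree simplicial set. -/
def toCofree : 𝟭 SSet.{u} ⟶ cofree where
  app X :=
    { app _ := ↾fun x _ φ ↦ some (X.map φ.op x)
      naturality _ l θ := ConcreteCategory.hom_ext _ _ fun x ↦ funext fun j ↦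
        funext fun (φ : j ⟶ l.unop) ↦
          congrArg some (ConcreteCategory.congr_hom (X.map_comp θ φ.op) x).symm }
  naturality _ _ f := hom_ext_apply fun _ x ↦ funext fun _ ↦ funext fun φ ↦
    congrArg some (NatTrans.naturality_apply f φ.op x).symm

instance (X : SSet.{u}) : Mono (toCofree.app X) := by
  refine (NatTrans.mono_iff_mono_app _).2 fun k ↦ (mono_iff_injective _).2 fun x y h ↦ ?_
  have h : some (X.map (𝟙 k) x) = some (X.map (𝟙 k) y) := congrFun (congrFun h k.unop) (𝟙 _)
  simpa using h

/-- The base point of a cofree simplicial set. -/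
def cofreePoint (X : SSet.{u}) : (cofree.obj X) _⦋0⦌ := fun _ _ ↦ none

/-- The contraction of a cofree simplicial set onto a vertex. -/
def cofreeContraction {X : SSet.{u}} (v : (cofree.obj X) _⦋0⦌) : Contraction v where
  homotopy :=
    { app _ := ↾fun x j φ ↦ if SSet.stdSimplex.asOrderHom x.2 (φ.toOrderHom 0) = 0 then
        v j (j.const ⦋0⦌ 0) else x.1 j φ }
  ι₀_homotopy := rfl
  ι₁_homotopy := rfl
  const_homotopy := hom_ext_apply fun k x ↦ funext fun j ↦ funext fun φ ↦ ite_self _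

end

section

variable {D : Type} [SmallCategory D] {A B : D ⥤ SSet.{u}}

lemma cofree_map_whiskerRight_homotopy {X Y : SSet.{u}} (f : X ⟶ Y) :
    cofree.map f ▷ Δ[1] ≫ (cofreeContraction (cofreePoint Y)).homotopy =
      (cofreeContraction (cofreePoint X)).homotopy ≫ cofree.map f :=
  hom_ext_apply fun k x ↦ funext fun j ↦ funext fun φ ↦ by
    refine Eq.trans ?_ (apply_ite (Option.map _) _ _ _).symm
    rfl

lemma isWeakEquivalence_mapSpacePre_snd (A B Z : D ⥤ SSet.{u}) :
    IsWeakEquivalence (mapSpacePre (snd (A ⋙ cofree) B) Z) := by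
  let s : B ⟶ (A ⋙ cofree) ⊗ B :=
    lift { app d := SSet.const (cofreePoint (A.obj d)) } (𝟙 B)
  have hs : s ≫ snd (A ⋙ cofree) B = 𝟙 B := lift_snd _ _
  let H : ((A ⋙ cofree) ⊗ B) ⋙ tensorRight Δ[1] ⟶ (A ⋙ cofree) ⊗ B :=
    { app d := lift (fst _ _ ▷ _ ≫ (cofreeContraction (cofreePoint (A.obj d))).homotopy)
        (fst _ _ ≫ snd _ _)
      naturality d d' f := hom_ext_apply fun k x ↦ Prod.ext
        (app_congr (cofree_map_whiskerRight_homotopy (A.map f)) (x.1.1, x.2)) rfl }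
  have H' : SSet.Homotopy (mapSpacePre (snd (A ⋙ cofree) B ≫ s) Z)
      (mapSpacePre (𝟙 ((A ⋙ cofree) ⊗ B)) Z) :=
    mapSpacePreHomotopy H (fun d ↦ rfl) (fun d ↦ rfl) Z
  refine isWeakEquivalence_of_homotopy (g := mapSpacePre s Z) (homotopyMk (fst _ _) rfl ?_) H'
  change mapSpacePre (𝟙 B) Z = mapSpacePre (s ≫ snd (A ⋙ cofree) B) Z
  rw [hs]

theorem isWeakEquivalence_mapSpacePre_of_contraction {i : D ⥤ SimplexCategory}
    (hi : IsInitialSegment i) (t : B ⟶ i ⋙ SSet.stdSimplex.{u}) (f : A ⟶ B)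
    {v : ∀ d, (A.obj d) _⦋0⦌} (c : ∀ d, Contraction (v d))
    (c' : ∀ d, Contraction ((f.app d).app _ (v d))) {Z : SimplexCategory ⥤ SSet.{u}}
    (hZ : IsFibrantCosimplicial Z) : IsWeakEquivalence (mapSpacePre f (i ⋙ Z)) := by
  let j : A ⟶ (A ⋙ cofree) ⊗ B := lift (Functor.whiskerLeft A toCofree) f
  have hj (d : D) : SSet.anodyneExtensions (j.app d) := by
    have : Mono (j.app d ≫ fst _ _) := inferInstanceAs (Mono (toCofree.app (A.obj d)))
    have : Mono (j.app d) := mono_of_mono (j.app d) (fst _ _)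
    exact (c d).anodyneExtensions_of_mono (j.app d)
      ((cofreeContraction _).tensor (c' d))
  have hf : mapSpacePre f (i ⋙ Z) =
      mapSpacePre (snd (A ⋙ cofree) B) (i ⋙ Z) ≫ mapSpacePre j (i ⋙ Z) := rfl
  rw [hf]
  exact (isWeakEquivalence_mapSpacePre_snd A B _).comp
    (isWeakEquivalence_mapSpacePre_of_anodyneExtensions hi (snd _ _ ≫ t) hj hZ)

lemma zerothVertex_app_mk₀_id (i : D ⥤ SimplexCategory) (d : D) :
    ((zerothVertex.{u} i).app d).app (op ⦋0⦌) ⟨ComposableArrows.mk₀ (op (Over.mk (𝟙 d)))⟩ =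
      SSet.stdSimplex.obj₀Equiv.symm 0 := by
  refine SSet.stdSimplex.objEquiv.injective (SimplexCategory.Hom.ext _ _ (OrderHom.ext _ _ ?_))
  funext
  change (i.map (𝟙 d)).toOrderHom 0 = 0
  rw [i.map_id]
  rfl

theorem isWeakEquivalence_mapSpacePre_zerothVertex {i : D ⥤ SimplexCategory}
    (hi : IsInitialSegment i) {Z : SimplexCategory ⥤ SSet.{u}} (hZ : IsFibrantCosimplicial Z) :
    IsWeakEquivalence (mapSpacePre (zerothVertex i) (i ⋙ Z)) :=
  isWeakEquivalence_mapSpacePre_of_contraction hi (𝟙 _) (zerothVertex i) overNerveContraction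
    (fun d ↦ zerothVertex_app_mk₀_id i d ▸ stdSimplexContraction (i.obj d)) hZ

end

/-! ### Truncation -/

lemma isInitialSegment_id : IsInitialSegment (𝟭 SimplexCategory) where
  full := inferInstance
  faithful := inferInstance
  obj_injective _ _ h := h
  exists_obj_eq _ p _ := ⟨p, rfl⟩

open SimplexCategory.Truncated (inclusion)

lemma isInitialSegment_inclusion (n : ℕ) : IsInitialSegment (inclusion n) where
  full := inferInstance
  faithful := inferInstance
  obj_injective _ _ h := ObjectProperty.FullSubcategory.ext h
  exists_obj_eq d p h := ⟨⟨p, h.trans d.property⟩, rfl⟩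

lemma exists_fac_of_mem_skeleton {q m : SimplexCategory} {n : ℕ} (f : m ⟶ q)
    (h : SSet.stdSimplex.objEquiv.symm f ∈
      ((SSet.stdSimplex.{u}.obj q).skeleton (n + 1)).obj (op m)) :
    ∃ (r : SimplexCategory) (e : m ⟶ r) (ν : r ⟶ q), r.len ≤ n ∧ Epi e ∧ Mono ν ∧ e ≫ ν = f := by
  change _ ∈ (⨆ (i : Fin (n + 1)) (x : (SSet.stdSimplex.{u}.obj q).nonDegenerate i),
    SSet.Subcomplex.ofSimplex x.1).obj (op m) at h
  simp only [Subfunctor.iSup_obj, Set.mem_iUnion] at h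
  obtain ⟨i, ⟨x, hx⟩, hfx⟩ := h
  obtain ⟨g, hg⟩ := (SSet.Subcomplex.mem_ofSimplex_obj_iff _ _).1 hfx
  have : Mono (SSet.stdSimplex.objEquiv x) := (SSet.stdSimplex.mem_nonDegenerate_iff_mono x).1 hx
  refine ⟨Limits.image g, Limits.factorThruImage g, Limits.image.ι g ≫ SSet.stdSimplex.objEquiv x,
    (SimplexCategory.len_le_of_mono (Limits.image.ι g)).trans (Nat.le_of_lt_succ i.isLt),
    inferInstance, mono_comp _ _, ?_⟩
  rw [← Category.assoc, Limits.image.fac]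
  exact SSet.stdSimplex.objEquiv.symm.injective hg

section

variable {n : ℕ} {q : SimplexCategory} {m : SimplexCategoryᵒᵖ}

lemma exists_minimal_skDelta (a : ((skDelta.{u} n).obj q).obj m) :
    ∃ (r : SimplexCategory.Truncated n) (ν : r.obj ⟶ q) (b : ((skDelta.{u} n).obj r.obj).obj m),
      ((skDelta.{u} n).map ν).app m b = a ∧
        ∀ (p : SimplexCategory) (μ : p ⟶ q) (c : ((skDelta.{u} n).obj p).obj m), Mono μ →
          ((skDelta.{u} n).map μ).app m c = a →
          ∃ g : r.obj ⟶ p, g ≫ μ = ν ∧ ((skDelta.{u} n).map g).app m b = c := by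
  obtain ⟨a, ha⟩ := a
  obtain ⟨f, rfl⟩ := SSet.stdSimplex.objEquiv.symm.surjective a
  obtain ⟨r, e, ν, hr, he, _, rfl⟩ := exists_fac_of_mem_skeleton f ha
  refine ⟨⟨r, hr⟩, ν, ⟨SSet.stdSimplex.objEquiv.symm e,
    mem_skeleton_stdSimplex (Nat.lt_succ_of_le hr) _⟩, rfl, fun p μ c hμ hc ↦ ?_⟩
  obtain ⟨c, hc'⟩ := c
  obtain ⟨c, rfl⟩ := SSet.stdSimplex.objEquiv.symm.surjective c
  have := isSplitEpi_of_epi e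
  have sq : CommSq c e μ ν :=
    ⟨SSet.stdSimplex.objEquiv.symm.injective (congrArg Subtype.val hc)⟩
  exact ⟨sq.lift, sq.fac_right,
    Subtype.ext (congrArg SSet.stdSimplex.objEquiv.symm sq.fac_left)⟩

variable {Z : SimplexCategory ⥤ SSet.{u}} {L : SSet.{u}}

/-- The relation between a simplex `(a, l)` of `sk_n Δ[q] × L` and the simplices `w` of `Z.obj q`
that any extension to `Δ` of the natural transformation `φ` on `Δ^{<n+1}` must assign to it. -/
def IsExtensionValue (φ : (inclusion n ⋙ skDelta.{u} n) ⋙ tensorRight L ⟶ inclusion n ⋙ Z)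
    (a : ((skDelta.{u} n).obj q).obj m) (l : L.obj m) (w : (Z.obj q).obj m) : Prop :=
  ∃ (p : SimplexCategory.Truncated n) (μ : p.obj ⟶ q) (b : ((skDelta.{u} n).obj p.obj).obj m),
    ((skDelta.{u} n).map μ).app m b = a ∧ w = (Z.map μ).app m ((φ.app p).app m (b, l))

variable {φ : (inclusion n ⋙ skDelta.{u} n) ⋙ tensorRight L ⟶ inclusion n ⋙ Z}
  {a : ((skDelta.{u} n).obj q).obj m} {l : L.obj m} {w : (Z.obj q).obj m}

lemma existsUnique_isExtensionValue
    (φ : (inclusion n ⋙ skDelta.{u} n) ⋙ tensorRight L ⟶ inclusion n ⋙ Z)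
    (a : ((skDelta.{u} n).obj q).obj m) (l : L.obj m) : ∃! w, IsExtensionValue φ a l w := by
  obtain ⟨r, ν, b, hb, hr⟩ := exists_minimal_skDelta a
  refine ⟨_, ⟨r, ν, b, hb, rfl⟩, ?_⟩
  rintro _ ⟨p, μ, c, hc, rfl⟩
  have hs := (SimplexCategory.len_le_of_epi (Limits.factorThruImage μ)).trans p.property
  let s : SimplexCategory.Truncated n := ⟨Limits.image μ, hs⟩
  let f : p ⟶ s := ObjectProperty.homMk (Limits.factorThruImage μ)
  have hμ : f.hom ≫ Limits.image.ι μ = μ := Limits.image.fac μ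
  obtain ⟨g, rfl, hg⟩ := hr s.obj (Limits.image.ι μ) (((skDelta n).map f.hom).app m c)
    inferInstance (by rw [← map_comp_app_apply, hμ, hc])
  have hf := app_congr (φ.naturality f) (c, l)
  have hg' := app_congr (φ.naturality (ObjectProperty.homMk g : r ⟶ s)) (b, l)
  calc (Z.map μ).app m ((φ.app p).app m (c, l))
    _ = (Z.map (f.hom ≫ Limits.image.ι μ)).app m ((φ.app p).app m (c, l)) := by rw [hμ]
    _ = (Z.map (Limits.image.ι μ)).app m
        ((φ.app s).app m (((skDelta n).map f.hom).app m c, l)) := by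
      rw [map_comp_app_apply]
      exact congrArg ((Z.map (Limits.image.ι μ)).app m) hf.symm
    _ = (Z.map (Limits.image.ι μ)).app m
        ((φ.app s).app m (((skDelta n).map g).app m b, l)) := by rw [hg]
    _ = (Z.map (g ≫ Limits.image.ι μ)).app m ((φ.app r).app m (b, l)) := by
      rw [map_comp_app_apply]
      exact congrArg ((Z.map (Limits.image.ι μ)).app m) hg'

lemma IsExtensionValue.map {m' : SimplexCategoryᵒᵖ} (θ : m ⟶ m') (h : IsExtensionValue φ a l w) :
    IsExtensionValue φ (((skDelta.{u} n).obj q).map θ a) (L.map θ l) ((Z.obj q).map θ w) := by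
  obtain ⟨p, μ, b, rfl, rfl⟩ := h
  refine ⟨p, μ, ((skDelta.{u} n).obj p.obj).map θ b, NatTrans.naturality_apply _ _ _, ?_⟩
  rw [← NatTrans.naturality_apply]
  exact congrArg ((Z.map μ).app m') (NatTrans.naturality_apply (φ.app p) θ
    ((b, l) : ((skDelta n).obj p.obj ⊗ L).obj m)).symm

lemma IsExtensionValue.map_app {q' : SimplexCategory} (f : q ⟶ q')
    (h : IsExtensionValue φ a l w) :
    IsExtensionValue φ (((skDelta.{u} n).map f).app m a) l ((Z.map f).app m w) := by
  obtain ⟨p, μ, b, rfl, rfl⟩ := h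
  exact ⟨p, μ ≫ f, b, map_comp_app_apply _ _ _ _, (map_comp_app_apply _ _ _ _).symm⟩

lemma exists_whiskerLeft_inclusion_eq
    (φ : (inclusion n ⋙ skDelta.{u} n) ⋙ tensorRight L ⟶ inclusion n ⋙ Z) :
    ∃ Φ : skDelta.{u} n ⋙ tensorRight L ⟶ Z, Functor.whiskerLeft (inclusion n) Φ = φ := by
  choose Φ hΦ using fun q ↦ exists_hom_of_rel (X := (skDelta n).obj q ⊗ L) (W := Z.obj q)
    (fun _ x ↦ IsExtensionValue φ x.1 x.2) (fun _ x ↦ existsUnique_isExtensionValue φ x.1 x.2)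
    (fun _ _ θ _ _ ↦ IsExtensionValue.map θ)
  refine ⟨{ app := Φ, naturality := fun q q' f ↦ hom_ext_apply fun m x ↦ ?_ }, ?_⟩
  · exact (existsUnique_isExtensionValue φ _ x.2).unique (hΦ q' m _) ((hΦ q m x).map_app f)
  · refine tensor_hom_ext (A := inclusion n ⋙ skDelta n) fun p m a l ↦ ?_
    refine (existsUnique_isExtensionValue φ a l).unique (hΦ p.obj m (a, l)) ⟨p, 𝟙 _, a, ?_, ?_⟩
    · rw [(skDelta n).map_id]
      rfl
    · rw [Z.map_id]
      rfl

lemma whiskerLeft_inclusion_injective {Φ Ψ : skDelta.{u} n ⋙ tensorRight L ⟶ Z}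
    (h : Functor.whiskerLeft (inclusion n) Φ = Functor.whiskerLeft (inclusion n) Ψ) : Φ = Ψ := by
  refine tensor_hom_ext (A := skDelta n) fun q m a l ↦ ?_
  obtain ⟨r, ν, b, rfl, -⟩ := exists_minimal_skDelta a
  have hr : Φ.app r.obj = Ψ.app r.obj := NatTrans.congr_app h r
  refine (app_congr (Φ.naturality ν) (b, l)).trans
    (Eq.trans ?_ (app_congr (Ψ.naturality ν) (b, l)).symm)
  exact congrArg ((Z.map ν).app m) (app_congr hr (b, l))

end

lemma isIso_mapSpaceRestrict_skDelta (n : ℕ) (Z : SimplexCategory ⥤ SSet.{u}) :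
    IsIso (mapSpaceRestrict (inclusion n) (skDelta.{u} n) Z) := by
  refine (NatTrans.isIso_iff_isIso_app _).2 fun k ↦ (isIso_iff_bijective _).2 ?_
  exact ⟨fun _ _ ↦ whiskerLeft_inclusion_injective, exists_whiskerLeft_inclusion_eq⟩

lemma isIso_whiskerLeft_skDeltaι (n : ℕ) :
    IsIso (Functor.whiskerLeft (inclusion n) (skDeltaι.{u} n)) := by
  refine (NatTrans.isIso_iff_isIso_app _).2 fun q ↦ (NatTrans.isIso_iff_isIso_app _).2 fun k ↦
    (isIso_iff_bijective _).2 ?_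
  exact ⟨Subtype.val_injective, fun x ↦
    ⟨⟨x, mem_skeleton_stdSimplex (Nat.lt_succ_of_le q.property) x⟩, rfl⟩⟩

lemma isIso_mapSpacePre {D : Type} [SmallCategory D] {A A' : D ⥤ SSet.{u}} (a : A' ⟶ A) [IsIso a]
    (B : D ⥤ SSet.{u}) : IsIso (mapSpacePre a B) := by
  have hinv : mapSpacePre a B ≫ mapSpacePre (inv a) B = mapSpacePre (inv a ≫ a) B := rfl
  have hinv' : mapSpacePre (inv a) B ≫ mapSpacePre a B = mapSpacePre (a ≫ inv a) B := rfl
  rw [IsIso.inv_hom_id] at hinv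
  rw [IsIso.hom_inv_id] at hinv'
  exact ⟨mapSpacePre (inv a) B, hinv, hinv'⟩

theorem isWeakEquivalence_totNToHolimN {Z : SimplexCategory ⥤ SSet.{u}}
    (hZ : IsFibrantCosimplicial Z) (n : ℕ) : IsWeakEquivalence (totNToHolimN n Z) := by
  have := isIso_mapSpaceRestrict_skDelta n Z
  have := isIso_whiskerLeft_skDeltaι.{u} n
  let ι := Functor.whiskerLeft (inclusion n) (skDeltaι.{u} n)
  have := isIso_mapSpacePre (inv ι) (inclusion n ⋙ Z)
  have hz : zerothVertexN n = zerothVertex (inclusion n) ≫ inv ι := by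
    rw [IsIso.eq_comp_inv]
    rfl
  have hpre : mapSpacePre (zerothVertexN n) (inclusion n ⋙ Z) =
      mapSpacePre (inv ι) _ ≫ mapSpacePre (zerothVertex _) _ := by
    rw [hz]
    rfl
  rw [totNToHolimN, hpre]
  exact (isWeakEquivalence_of_isIso (mapSpaceRestrict (inclusion n) (skDelta n) Z)).comp
    ((isWeakEquivalence_of_isIso (mapSpacePre (inv ι) _)).comp
      (isWeakEquivalence_mapSpacePre_zerothVertex (isInitialSegment_inclusion n) hZ))

end CosimplicialSpace

end

open CosimplicialSpace in
theorem mainTheorem8 :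
    -- `z^*` is a weak equivalence, for `n = ∞` and for all finite `n`
    (∀ Z : SimplexCategory ⥤ SSet.{u}, IsFibrantCosimplicial Z →
      IsWeakEquivalence (totToHolim Z) ∧ ∀ n : ℕ, IsWeakEquivalence (totNToHolimN n Z)) ∧
    -- naturality of `z^*` in the cosimplicial space
    (∀ (Z W : SimplexCategory ⥤ SSet.{u}) (f : Z ⟶ W),
      totMap f ≫ totToHolim W = totToHolim Z ≫ holimMap f ∧
      ∀ n : ℕ, totNMap n f ≫ totNToHolimN n W = totNToHolimN n Z ≫ holimNMap n f) ∧
    -- compatibility for varying `0 ≤ n ≤ m ≤ ∞`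
    (∀ Z : SimplexCategory ⥤ SSet.{u},
      (∀ (n m : ℕ) (h : n ≤ m),
        totNRestrict h Z ≫ totNToHolimN n Z = totNToHolimN m Z ≫ holimNRestrict h Z) ∧
      ∀ n : ℕ, totRestrict n Z ≫ totNToHolimN n Z = totToHolim Z ≫ holimNOfHolim n Z) := by
  refine ⟨fun Z hZ ↦ ⟨isWeakEquivalence_mapSpacePre_zerothVertex isInitialSegment_id hZ,
    isWeakEquivalence_totNToHolimN hZ⟩, fun Z W f ↦ ⟨rfl, fun _ ↦ rfl⟩,
    fun Z ↦ ⟨fun n m h ↦ rfl, fun n ↦ rfl⟩⟩
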